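/- **Setting.** Let $\Sigma$ be a compact smooth $n$-manifold with boundary ($n\ge 1$), with smooth positive volume elements $d^nx$ on $\Sigma$ and $d\nu$ on $\partial\Sigma$. Fields are smooth maps $z=(z^A):\Sigma\to\mathbb R^m$; a history is a map $z(t,x)$ smooth on $\mathbb R\times\Sigma$. A *local function* is a smooth function of $t$, $x$ and finitely many spatial derivatives of $z$ at $x$. A *local functional* is $F[t,z]=\int_\Sigma f\,d^nx$ with $f$ local; $\frac{\delta F}{\delta z^A}$ denotes its functional (Euler–Lagrange) derivative, characterised by $\delta F=\int_\Sigma\frac{\delta F}{\delta z^A}\delta z^A\,d^nx$ for variations supported in the interior. For arbitrary variations put $\oint\Theta_F[\delta z]:=\delta F-\int_\Sigma \frac{\delta F}{\delta z^A}\delta z^A\,d^nx$. Boundary terms $\oint V$ are integrals over $\partial\Sigma$ of local functions $V(t,z)$. Let $\sigma^{AB}$ be a constant, antisymmetric, invertible matrix with inverse $\sigma_{AB}$, $H[z]$ a local functional and $\chi_I^\alpha(z)$ local functions, all without explicit time dependence. Put $\{F,G\}=\int_\Sigma\frac{\delta F}{\delta z^A}\sigma^{AB}\frac{\delta G}{\delta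 z^B}d^nx$, $\delta_G z^A=\sigma^{AB}\frac{\delta G}{\delta z^B}$, $$\{F,G\}_\zeta=\{F,G\}+\oint\Theta_F[\delta_Gz]-\oint\Theta_G[\delta_Fz],\qquad S[z]=\int_{t_0}^{t_1}dt\Big(\int_\Sigma\tfrac12 z^A\sigma_{AB}\dot z^B\,d^nx-H[z]\Big).$$ The values $\zeta^\alpha=\chi_I^\alpha(z)|_{\partial\Sigma}$ are the external sources (internal boundary conditions). The external boundary conditions on a history are $\chi_E^{k,\alpha}|_{\partial\Sigma}=0$ for all $k>0$ and all $t$, where $\chi_E^{k,\alpha}=(d_t-\delta_t)^k\chi_I^\alpha$, $\delta_t=\partial_t+\delta_H$; let $\mathcal A$ be the set of histories that satisfy them. A variation $\delta z$ at $z\in\mathcal A$ *preserves the internal boundary conditions* if $\delta\chi_I^\alpha|_{\partial\Sigma}=0$ and $\delta\chi_E^{k,\alpha}|_{\partial\Sigma}=0$ for all $\alpha$ and $k>0$. Standing assumptions: $\mathcal A\neq\emptyset$; the boundary conditions are regular, i.e. every variation at $z\in\mathcal A$ preserving the internal boundary conditions is tangent at $z$ to a smooth curve of histories in $\mathcal A$;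 and the action is well defined, i.e. $\delta H=\int_\Sigma\frac{\delta H}{\delta z^A}\delta z^A\,d^nx$ for all $z\in\mathcal A$ and all variations preserving the internal boundary conditions. A transformation $\delta_Z$ of histories is *compatible with the boundary conditions* if for all $z\in\mathcal A$ $$\delta_Z\chi_E^{k,\alpha}|_{\partial\Sigma}=0\ (k>0),\qquad[\delta_Z,\delta]\chi_I^\alpha|_{\partial\Sigma}=0$$ for all smooth field-dependent variations $\delta$ preserving the internal boundary conditions at every point of $\mathcal A$. A local functional $G[t,z]$ is *generalized differentiable* if $\delta G=\int_\Sigma\frac{\delta G}{\delta z^A}\delta z^A\,d^nx$ for all $z\in\mathcal A$, all $t$ and all variations preserving the internal boundary conditions, and $\delta_G$ is compatible with the boundary conditions. A local transformation $\delta_Zz^A=Z^A(t,z)$ is an *external symmetry of the action with boundary term $\oint V$* if it is compatible with the boundary conditions, there is a local function $U$ such that $$\delta_ZS[z]=\int_{t_0}^{t_1}dt\Big\{\frac{d}{dt}\int_\Sigma U(t,z)\,d^nx+\oint_{\partial\Sigma}V(t,z)\Big\}\qquad\text{for all }z\in\mathcal A\text{ and all }t_0,t_1,$$ and $\delta\oint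 V=0$ at all $z\in\mathcal A$, for all variations preserving the internal boundary conditions. It is an *external symmetry* if this holds for some local $V$. **Theorem.** Let $\delta_Zz^A=Z^A(t,z)$ be a local transformation. Then $\delta_Z$ is an external symmetry of the action if and only if there are a local $V$ and a generalized differentiable functional $G[t,z]$ such that $$Z^A=\{z^A,G\}=\sigma^{AB}\frac{\delta G}{\delta z^B}\ \text{ at all configurations},\qquad \partial_tG+\{G,H\}_\zeta=\oint_{\partial\Sigma}V\ \text{ for all } z\in\mathcal A \text{ and all } t,$$ $$\delta\oint_{\partial\Sigma}V=0\quad\text{at all } z\in\mathcal A\text{, for all variations preserving the internal boundary conditions,}$$ where $\partial_t$ acts only on the explicit time dependence. More precisely, for every local $V$, $\delta_Z$ is an external symmetry with boundary term $\oint V$ if and only if such a $G$ exists for this same $V$. -/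

import Mathlib

open MeasureTheory Matrix
open scoped Manifold ContDiff

noncomputable section

namespace ExtSym

/-! ### Space, configurations, histories

`M` is the spatial manifold with boundary, of dimension `n`. A configuration is a smooth map
`M → (Fin m → ℝ)` with components `z^A`; a history is a map `ℝ → M → (Fin m → ℝ)` that is smooth
jointly in time and space. -/

section Basic

variable {n : ℕ} [NeZero n] {M : Type*} [TopologicalSpace M]
  [ChartedSpace (EuclideanHalfSpace n) M]

/-- In every chart the measure `μ` has a smooth positive density with respect to the
reference measure `Λ` of the model space. -/
def HasSmoothPositiveDensity [MeasurableSpace M] (Λ : Measure (EuclideanSpace ℝ (Fin n)))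
    (μ : Measure M) : Prop :=
  ∀ x₀ : M, ∃ ρ : EuclideanSpace ℝ (Fin n) → ℝ,
    ContDiffOn ℝ ∞ ρ (extChartAt (𝓡∂ n) x₀).target ∧
    (∀ y ∈ (extChartAt (𝓡∂ n) x₀).target, 0 < ρ y) ∧
    (μ.restrict (extChartAt (𝓡∂ n) x₀).source).map (extChartAt (𝓡∂ n) x₀) =
      (Λ.restrict (extChartAt (𝓡∂ n) x₀).target).withDensity fun y => ENNReal.ofReal (ρ y)

/-- `μ` is a smooth positive volume element `dⁿx` on `M`. -/
def IsVolumeElement [MeasurableSpace M] (μ : Measure M) : Prop :=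
  HasSmoothPositiveDensity (n := n) volume μ

/-- `ν` is a smooth positive volume element of the boundary of `M`, extended by zero to `M`:
in charts it has a smooth positive density with respect to the `(n-1)`-dimensional measure of the
hyperplane that bounds the half-space. -/
def IsBoundaryVolumeElement [MeasurableSpace M] (ν : Measure M) : Prop :=
  HasSmoothPositiveDensity (n := n)
    ((Measure.hausdorffMeasure ((n : ℝ) - 1)).restrict (frontier (Set.range (𝓡∂ n)))) ν

/-- Smooth configurations (also used for smooth maps to any normed space). -/
def SmoothConfig {W : Type*} [NormedAddCommGroup W] [NormedSpace ℝ W] (f : M → W) : Prop :=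
  ContMDiff (𝓡∂ n) 𝓘(ℝ, W) ∞ f

/-- Families of maps on `M`, smooth jointly in the parameter (in a normed space `P`) and the
point. -/
def SmoothFamily {P W : Type*} [NormedAddCommGroup P] [NormedSpace ℝ P] [NormedAddCommGroup W]
    [NormedSpace ℝ W] (f : P → M → W) : Prop :=
  ContMDiff (𝓘(ℝ, P).prod (𝓡∂ n)) 𝓘(ℝ, W) ∞ fun q : P × M => f q.1 q.2

/-- `f` and `g` have the same derivatives of order at most `k` at `x`, in the chart at `x`. -/
def SameJet {W : Type*} [NormedAddCommGroup W] [NormedSpace ℝ W] (k : ℕ) (f g : M → W) (x : M) :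
    Prop :=
  ∀ j ≤ k,
    iteratedFDerivWithin ℝ j (f ∘ (extChartAt (𝓡∂ n) x).symm) (Set.range (𝓡∂ n))
        (extChartAt (𝓡∂ n) x x) =
      iteratedFDerivWithin ℝ j (g ∘ (extChartAt (𝓡∂ n) x).symm) (Set.range (𝓡∂ n))
        (extChartAt (𝓡∂ n) x x)

end Basic

/-- A smooth local function `P(t, x, z, ∂z, …, ∂ᵏz)` of the time, the point and finitely many
spatial derivatives of the configuration, with values in `W`: the value at `x` depends only on the
`k`-jet of the configuration at `x`, and the dependence on `t` and on the jet is smooth, which is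
expressed by saying that smooth finite-dimensional families of configurations are sent to smooth
families. (This is the same as a smooth map from `ℝ ×` the bundle of `k`-jets to `W`.) -/
structure LocalOp (n : ℕ) [NeZero n] (m : ℕ) (M : Type*) [TopologicalSpace M]
    [ChartedSpace (EuclideanHalfSpace n) M] (W : Type*) [NormedAddCommGroup W]
    [NormedSpace ℝ W] where
  /-- the value `P(t, x, z, ∂z, …)` -/
  toFun : ℝ → (M → (Fin m → ℝ)) → M → W
  /-- a bound for the order of the derivatives that occur -/
  order : ℕ
  jet : ∀ (t : ℝ) (f g : M → (Fin m → ℝ)) (x : M), SmoothConfig (n := n) f →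
    SmoothConfig (n := n) g → SameJet (n := n) order f g x → toFun t f x = toFun t g x
  smooth : ∀ (p : ℕ) (f : EuclideanSpace ℝ (Fin p) → M → (Fin m → ℝ)),
    SmoothFamily (n := n) f →
    SmoothFamily (n := n) fun (q : ℝ × EuclideanSpace ℝ (Fin p)) (x : M) => toFun q.1 (f q.2) x

namespace LocalOp

variable {n : ℕ} [NeZero n] {m : ℕ} {M : Type*} [TopologicalSpace M]
  [ChartedSpace (EuclideanHalfSpace n) M] {W : Type*} [NormedAddCommGroup W] [NormedSpace ℝ W]

/-- No explicit dependence on the time. -/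
def IsAutonomous (P : LocalOp n m M W) : Prop :=
  ∀ (s t : ℝ) (z : M → (Fin m → ℝ)), SmoothConfig (n := n) z → ∀ x, P.toFun s z x = P.toFun t z x

end LocalOp

/-- The variation `δF(z)[y] = d/dε F(z + ε y)` at `ε = 0` of a functional `F` of configurations. -/
def variation {m : ℕ} {M : Type*} (F : (M → (Fin m → ℝ)) → ℝ) (z y : M → (Fin m → ℝ)) : ℝ :=
  deriv (fun ε : ℝ => F (z + ε • y)) 0

/-- A local functional `F[t, z] = ∫ f(t, x, z, ∂z, …) dⁿx` together with its functional
derivative `δF/δz^A`, the local function characterised by `δF(z)[w] = ∫ (δF/δz^A) w^A dⁿx` for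
all variations `w` supported in the interior of `M`. (For a volume element `μ` the functional
derivative of a given density exists, by integration by parts, and is unique.) -/
structure LocalFunctional (n : ℕ) [NeZero n] (m : ℕ) {M : Type*} [TopologicalSpace M]
    [ChartedSpace (EuclideanHalfSpace n) M] [MeasurableSpace M] (μ : Measure M) where
  /-- the integrand -/
  density : LocalOp n m M ℝ
  /-- the functional derivative, with components `δF/δz^A` -/
  grad : LocalOp n m M (Fin m → ℝ)
  isGrad : ∀ (t : ℝ) (z w : M → (Fin m → ℝ)), SmoothConfig (n := n) z → SmoothConfig (n := n) w →
    tsupport w ⊆ (𝓡∂ n).interior M →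
    variation (fun z => ∫ x, density.toFun t z x ∂μ) z w = ∫ x, grad.toFun t z x ⬝ᵥ w x ∂μ

namespace LocalFunctional

variable {n : ℕ} [NeZero n] {m : ℕ} {M : Type*} [TopologicalSpace M]
  [ChartedSpace (EuclideanHalfSpace n) M] [MeasurableSpace M] {μ : Measure M}

/-- The value `F[t, z]`. -/
def eval (F : LocalFunctional n m μ) (t : ℝ) (z : M → (Fin m → ℝ)) : ℝ :=
  ∫ x, F.density.toFun t z x ∂μ

/-- The boundary term `∮ Θ_F[δz]` of the variation of `F`, defined by
`δF = ∫ (δF/δz^A) δz^A dⁿx + ∮ Θ_F[δz]`. -/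
def boundaryTerm (F : LocalFunctional n m μ) (t : ℝ) (z y : M → (Fin m → ℝ)) : ℝ :=
  variation (F.eval t) z y - ∫ x, F.grad.toFun t z x ⬝ᵥ y x ∂μ

/-- The hamiltonian vector field `σ^{AB} δF/δz^B`. -/
def ham (σ : Matrix (Fin m) (Fin m) ℝ) (F : LocalFunctional n m μ) (t : ℝ)
    (z : M → (Fin m → ℝ)) (x : M) : Fin m → ℝ :=
  σ *ᵥ F.grad.toFun t z x

/-- The Poisson bracket `{F, G} = ∫ (δF/δz^A) σ^{AB} (δG/δz^B) dⁿx`. -/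
def poisson (σ : Matrix (Fin m) (Fin m) ℝ) (F G : LocalFunctional n m μ) (t : ℝ)
    (z : M → (Fin m → ℝ)) : ℝ :=
  ∫ x, F.grad.toFun t z x ⬝ᵥ (σ *ᵥ G.grad.toFun t z x) ∂μ

/-- The modified bracket `{F, G}_ζ = {F, G} + ∮ Θ_F[δ_G z] - ∮ Θ_G[δ_F z]`. -/
def modifiedBracket (σ : Matrix (Fin m) (Fin m) ℝ) (F G : LocalFunctional n m μ) (t : ℝ)
    (z : M → (Fin m → ℝ)) : ℝ :=
  poisson σ F G t z + F.boundaryTerm t z (ham σ G t z) - G.boundaryTerm t z (ham σ F t z)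

end LocalFunctional

/-! ### Operators on histories and variations of histories -/

/-- Histories `z(t, x)`; smoothness is imposed separately by `SmoothFamily`. -/
abbrev History (m : ℕ) (M : Type*) := ℝ → M → (Fin m → ℝ)

/-- Functions of a history, the time and the point. -/
abbrev HistoryOp (m : ℕ) (M : Type*) := History m M → ℝ → M → ℝ

section Operators

variable {m : ℕ} {M : Type*}

/-- The velocity `ż = d_t z`. -/
def velocity (z : History m M) : History m M := fun t x => deriv (fun s => z s x) t

/-- The total time derivative `d_t P`. -/
def totalDt (P : HistoryOp m M) : HistoryOp m M := fun z t x => deriv (fun s => P z s x) t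

/-- The variation `δ_X P` of `P` under the field dependent variation `δz = X[z]`. -/
def vary (X : History m M → History m M) (P : HistoryOp m M) : HistoryOp m M :=
  fun z t x => deriv (fun ε : ℝ => P (z + ε • X z) t x) 0

/-- The variation of `P` at the history `z` along a given `y`. -/
def varyAt (y : History m M) (P : HistoryOp m M) (z : History m M) (t : ℝ) (x : M) : ℝ :=
  vary (fun _ => y) P z t x

variable {n : ℕ} [NeZero n] [TopologicalSpace M] [ChartedSpace (EuclideanHalfSpace n) M]

/-- The transformation `δz = Z(t, z)` of histories given by a local function `Z`. -/
def transf (Z : LocalOp n m M (Fin m → ℝ)) : History m M → History m M :=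
  fun z t => Z.toFun t (z t)

/-- Smooth field dependent variations: smooth finite-dimensional families of histories are sent to
smooth families. -/
def SmoothVariation (n : ℕ) [NeZero n] [ChartedSpace (EuclideanHalfSpace n) M]
    (X : History m M → History m M) : Prop :=
  ∀ (p : ℕ) (f : EuclideanSpace ℝ (Fin p) → History m M),
    SmoothFamily (n := n) (fun (q : EuclideanSpace ℝ (Fin p) × ℝ) x => f q.1 q.2 x) →
    SmoothFamily (n := n) (fun (q : EuclideanSpace ℝ (Fin p) × ℝ) x => X (f q.1) q.2 x)

end Operators

/-! ### Hamiltonian field theories with boundary conditions as external sources -/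

/-- The data of the theory: the constant antisymmetric invertible matrix `σ^{AB}`, the
hamiltonian `H[z]` and the local operators `χ_I^α(z)` of the internal boundary conditions
`χ_I^α(z) = ζ^α` on the boundary, all without explicit dependence on the time. -/
structure FieldTheory (n : ℕ) [NeZero n] (m : ℕ) {M : Type*} [TopologicalSpace M]
    [ChartedSpace (EuclideanHalfSpace n) M] [MeasurableSpace M] (μ : Measure M) (ι : Type*) where
  σ : Matrix (Fin m) (Fin m) ℝ
  σ_antisymm : σᵀ = -σ
  σ_invertible : IsUnit σ.det
  H : LocalFunctional n m μ
  H_autonomous : H.density.IsAutonomous ∧ H.grad.IsAutonomous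
  χ : ι → LocalOp n m M ℝ
  χ_autonomous : ∀ α, (χ α).IsAutonomous

namespace FieldTheory

variable {n : ℕ} [NeZero n] {m : ℕ} {M : Type*} [TopologicalSpace M]
  [ChartedSpace (EuclideanHalfSpace n) M] [MeasurableSpace M] {μ : Measure M} {ι : Type*}

/-- The variation `δ_H z^A = σ^{AB} δH/δz^B` of histories. -/
def deltaH (T : FieldTheory n m μ ι) : History m M → History m M :=
  fun z t => LocalFunctional.ham T.σ T.H t (z t)

/-- `χ_I^α` as an operator on histories. -/
def chiI (T : FieldTheory n m μ ι) (α : ι) : HistoryOp m M := fun z t => (T.χ α).toFun t (z t)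

/-- `χ_E^{k,α} = (d_t - δ_t)^k χ_I^α`. Here `δ_t = ∂/∂t + δ_H` acts as `δ_H`, because nothing
depends explicitly on the time. -/
def chiE (T : FieldTheory n m μ ι) (α : ι) : ℕ → HistoryOp m M
  | 0 => T.chiI α
  | k + 1 => totalDt (T.chiE α k) - vary T.deltaH (T.chiE α k)

/-- The smooth histories that satisfy the external boundary conditions
`χ_E^{k,α} = 0` on the boundary for all `k > 0`. -/
def Admissible (T : FieldTheory n m μ ι) (z : History m M) : Prop :=
  SmoothFamily (n := n) z ∧
    ∀ (α : ι) (k : ℕ), 0 < k → ∀ (t : ℝ), ∀ x ∈ (𝓡∂ n).boundary M, T.chiE α k z t x = 0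

/-- The smooth `y` is a variation at `z` with `δχ_E = 0` on the boundary. -/
def PreservesExternal (T : FieldTheory n m μ ι) (z y : History m M) : Prop :=
  SmoothFamily (n := n) y ∧
    ∀ (α : ι) (k : ℕ), 0 < k → ∀ (t : ℝ), ∀ x ∈ (𝓡∂ n).boundary M,
      varyAt y (T.chiE α k) z t x = 0

/-- The variation `y` at `z` preserves the internal boundary conditions: `δχ_I = 0` and
`δχ_E = 0` on the boundary. -/
def PreservesInternal (T : FieldTheory n m μ ι) (z y : History m M) : Prop :=
  T.PreservesExternal z y ∧
    ∀ (α : ι) (t : ℝ), ∀ x ∈ (𝓡∂ n).boundary M, varyAt y (T.chiI α) z t x = 0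

/-- Regularity of the boundary conditions: every (infinitesimal) variation that preserves the
internal boundary conditions is tangent to a smooth curve of histories that satisfy the external
boundary conditions. It holds for instance when all `χ_E^{k,α}` are affine in the fields. -/
def Regular (T : FieldTheory n m μ ι) : Prop :=
  ∀ z y : History m M, T.Admissible z → T.PreservesInternal z y →
    ∃ c : ℝ → History m M,
      SmoothFamily (n := n) (fun (q : ℝ × ℝ) x => c q.1 q.2 x) ∧
      c 0 = z ∧ (∀ s, T.Admissible (c s)) ∧
      ∀ t x, deriv (fun s => c s t x) 0 = y t x

/-- The variation of `F` has no boundary term, `δF = ∫ (δF/δz^A) δz^A dⁿx`, for all variations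
preserving the internal boundary conditions. -/
def NoBoundaryTerm (T : FieldTheory n m μ ι) (F : LocalFunctional n m μ) : Prop :=
  ∀ z y : History m M, T.Admissible z → T.PreservesInternal z y → ∀ t : ℝ,
    variation (F.eval t) (z t) (y t) = ∫ x, F.grad.toFun t (z t) x ⬝ᵥ y t x ∂μ

/-- The requirements on a transformation `δ_Z z = Z[z]` of histories:
`δ_Z χ_E = 0` and `[δ_Z, δ] χ_I = 0` on the boundary, at all `z` with `χ_E = 0` on the boundary,
for all (field dependent) variations `δz = Q[z]` that preserve the internal boundary conditions. -/
def BoundaryCompatible (T : FieldTheory n m μ ι) (Z : History m M → History m M) : Prop :=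
  (∀ z, T.Admissible z → T.PreservesExternal z (Z z)) ∧
  ∀ Q : History m M → History m M, SmoothVariation n Q →
    (∀ z, T.Admissible z → T.PreservesInternal z (Q z)) →
    ∀ z, T.Admissible z → ∀ (α : ι) (t : ℝ), ∀ x ∈ (𝓡∂ n).boundary M,
      vary Z (vary Q (T.chiI α)) z t x - vary Q (vary Z (T.chiI α)) z t x = 0

/-- Generalized differentiable functionals `G[t, z]`. -/
def GeneralizedDifferentiable (T : FieldTheory n m μ ι) (G : LocalFunctional n m μ) : Prop :=
  T.NoBoundaryTerm G ∧
  T.BoundaryCompatible fun z t => LocalFunctional.ham T.σ G t (z t)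

/-- The action `S[z] = ∫ dt (∫ ½ z^A σ_{AB} ż^B dⁿx - H[z])` on the time interval from `t₀` to
`t₁`, where `σ_{AB}` is the inverse of `σ^{AB}`. -/
def action (T : FieldTheory n m μ ι) (t₀ t₁ : ℝ) (z : History m M) : ℝ :=
  ∫ t in t₀..t₁,
    ((∫ x, (1 / 2 : ℝ) * (z t x ⬝ᵥ (T.σ⁻¹ *ᵥ velocity z t x)) ∂μ) - T.H.eval t (z t))

/-- The boundary integral `∮ V(t, z)` of a local function of the fields and their
derivatives at the boundary; `ν` is the volume element of the boundary. -/
def boundaryIntegral (ν : Measure M) (V : LocalOp n m M ℝ) (t : ℝ) (z : M → (Fin m → ℝ)) : ℝ :=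
  ∫ x in (𝓡∂ n).boundary M, V.toFun t z x ∂ν

/-- `δ ∮ V = 0` for all variations preserving the internal boundary conditions. -/
def BoundaryInvariant (T : FieldTheory n m μ ι) (ν : Measure M) (V : LocalOp n m M ℝ) : Prop :=
  ∀ z y : History m M, T.Admissible z → T.PreservesInternal z y → ∀ t : ℝ,
    variation (boundaryIntegral ν V t) (z t) (y t) = 0

/-- `δ z^A = Z^A(t, z)` is an external symmetry of the action with boundary term `∮ V`:
`δ S = ∫ dt { d/dt ∫ U(t, z) dⁿx + ∮ V }` on all time intervals for some local `U`,
and `δ ∮ V = 0` for all variations preserving the internal boundary conditions. -/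
def IsExternalSymmetryWith (T : FieldTheory n m μ ι) (ν : Measure M)
    (Z : LocalOp n m M (Fin m → ℝ)) (V : LocalOp n m M ℝ) : Prop :=
  T.BoundaryCompatible (transf Z) ∧
  (∃ U : LocalOp n m M ℝ, ∀ z : History m M, T.Admissible z → ∀ t₀ t₁ : ℝ,
    deriv (fun ε : ℝ => T.action t₀ t₁ (z + ε • transf Z z)) 0 =
      ∫ t in t₀..t₁,
        (deriv (fun s => ∫ x, U.toFun s (z s) x ∂μ) t + boundaryIntegral ν V t (z t))) ∧
  T.BoundaryInvariant ν V

/-- External symmetries of the action. -/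
def IsExternalSymmetry (T : FieldTheory n m μ ι) (ν : Measure M)
    (Z : LocalOp n m M (Fin m → ℝ)) : Prop :=
  ∃ V : LocalOp n m M ℝ, T.IsExternalSymmetryWith ν Z V

/-- `G` is a generalized differentiable functional that generates `Z`, that is
`Z^A = σ^{AB} δG/δz^B`, and it satisfies `∂_t G + {G, H}_ζ = ∮ V` on all histories satisfying the
external boundary conditions, with `δ ∮ V = 0` for all variations preserving the internal ones. -/
def IsGenerator (T : FieldTheory n m μ ι) (ν : Measure M)
    (Z : LocalOp n m M (Fin m → ℝ)) (V : LocalOp n m M ℝ) (G : LocalFunctional n m μ) : Prop :=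
  T.GeneralizedDifferentiable G ∧
  (∀ (t : ℝ) (z : M → (Fin m → ℝ)), SmoothConfig (n := n) z →
    ∀ x, Z.toFun t z x = T.σ *ᵥ G.grad.toFun t z x) ∧
  (∀ z : History m M, T.Admissible z → ∀ t : ℝ,
    deriv (fun s => G.eval s (z t)) t + LocalFunctional.modifiedBracket T.σ G T.H t (z t) =
      boundaryIntegral ν V t (z t)) ∧
  T.BoundaryInvariant ν V

end FieldTheory

end ExtSym

end

open MeasureTheory Matrix
open scoped Manifold ContDiff

/-! For a local transformation `Z`, integrating the kinetic term by parts in time gives `δ_Z S = ∫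
dt (d/dt ∫ ½ z σ Z - ∫ (σ Z)·ż - δ_Z H)`, with `σ` the inverse matrix. As the time interval is
arbitrary, the symmetry condition is equivalent (`forall_deriv_action_eq_iff`) to an identity at
each time, `Balance`: `d/dt ∫ g = ∫ (σ Z)·ż + δ_Z H + ∮ V` on admissible histories, with `g = ½ z σ
Z - U`.

The candidate generator is `G = ∫ g` with gradient `σ Z`. To see that `δG` has no boundary term, let
`y` preserve the internal boundary conditions. So does `(t - t₀) y`, because `d_t - δ_H`
differentiates the factor `t - t₀` only once: `δ_{(t - t₀) y} χ_E^k = (t - t₀) δ_y χ_E^k + k δ_y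
χ_E^{k-1}`. Regularity provides a curve of admissible histories tangent to `(t - t₀) y`. At time
`t₀` the configuration is then stationary along the curve while the velocity moves by `y`, so
differentiating the balance leaves exactly `δ_y G = ∫ (σ Z)·y` (`variation_eq_of_balance`). Cutting
off an admissible history in the interior extends this, for interior variations, to all
configurations (`isGrad_of_forall_preservesInternal`).

Finally, `ż - δ_H z` preserves the internal boundary conditions on admissible histories, since it
varies `χ_E^k` into `χ_E^{k+1}`. Hence the boundary terms of `δG` along `ż` and along `δ_H z`
coincide, and the balance becomes `∂_t G + {G, H}_ζ = ∮ V` (`balance_iff_modifiedBracket`). The same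
equivalence, with `U = ½ z σ Z - g`, gives the converse.

The analytic groundwork is a chain rule: first-order variations of local functions, and of the
operators `χ_E^k`, depend only on the tangent of a curve of fields. -/

namespace ExtSym

/-! ### Calculus of smooth families of maps on a manifold with boundary. -/

section Families

variable {n : ℕ} [NeZero n] {M : Type*} [TopologicalSpace M]
  [ChartedSpace (EuclideanHalfSpace n) M]
  {P : Type*} [NormedAddCommGroup P] [NormedSpace ℝ P]
  {P' : Type*} [NormedAddCommGroup P'] [NormedSpace ℝ P']
  {W : Type*} [NormedAddCommGroup W] [NormedSpace ℝ W]
  {W' : Type*} [NormedAddCommGroup W'] [NormedSpace ℝ W']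

theorem SmoothFamily.comp {f : P → M → W} (hf : SmoothFamily (n := n) f) {φ : P' → P}
    (hφ : ContDiff ℝ ∞ φ) : SmoothFamily (n := n) fun q => f (φ q) :=
  ContMDiff.comp (g := fun q : P × M => f q.1 q.2) (f := fun q : P' × M => (φ q.1, q.2)) hf
    ((hφ.contMDiff.comp contMDiff_fst).prodMk contMDiff_snd)

theorem SmoothFamily.map {f : P → M → W} (hf : SmoothFamily (n := n) f) {g : W → W'}
    (hg : ContDiff ℝ ∞ g) : SmoothFamily (n := n) fun q x => g (f q x) :=
  hg.contMDiff.comp hf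

theorem SmoothFamily.prodMk {f : P → M → W} {g : P → M → W'} (hf : SmoothFamily (n := n) f)
    (hg : SmoothFamily (n := n) g) : SmoothFamily (n := n) fun q x => (f q x, g q x) :=
  ContMDiff.prodMk_space hf hg

theorem SmoothFamily.param {g : P → W} (hg : ContDiff ℝ ∞ g) :
    SmoothFamily (n := n) fun q (_ : M) => g q :=
  hg.contMDiff.comp contMDiff_fst

theorem SmoothFamily.add {f g : P → M → W} (hf : SmoothFamily (n := n) f)
    (hg : SmoothFamily (n := n) g) : SmoothFamily (n := n) fun q => f q + g q :=
  ContMDiff.add hf hg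

theorem SmoothFamily.sub {f g : P → M → W} (hf : SmoothFamily (n := n) f)
    (hg : SmoothFamily (n := n) g) : SmoothFamily (n := n) fun q => f q - g q :=
  ContMDiff.sub hf hg

theorem SmoothFamily.smul {f : P → M → ℝ} {g : P → M → W} (hf : SmoothFamily (n := n) f)
    (hg : SmoothFamily (n := n) g) : SmoothFamily (n := n) fun q x => f q x • g q x :=
  ContMDiff.smul hf hg

theorem SmoothFamily.clm (L : W →L[ℝ] W') {f : P → M → W} (hf : SmoothFamily (n := n) f) :
    SmoothFamily (n := n) fun q x => L (f q x) :=
  hf.map L.contDiff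

theorem SmoothFamily.param_smul {a : P → ℝ} (ha : ContDiff ℝ ∞ a) {g : P → M → W}
    (hg : SmoothFamily (n := n) g) : SmoothFamily (n := n) fun q => a q • g q :=
  (SmoothFamily.param ha).smul hg

theorem SmoothFamily.dotProduct {m : ℕ} {f g : P → M → (Fin m → ℝ)}
    (hf : SmoothFamily (n := n) f) (hg : SmoothFamily (n := n) g) :
    SmoothFamily (n := n) fun q x => f q x ⬝ᵥ g q x := by
  refine (hf.prodMk hg).map (g := fun p : (Fin m → ℝ) × (Fin m → ℝ) => p.1 ⬝ᵥ p.2) ?_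
  unfold _root_.dotProduct
  fun_prop

theorem SmoothFamily.mulVec {m : ℕ} (A : Matrix (Fin m) (Fin m) ℝ) {f : P → M → (Fin m → ℝ)}
    (hf : SmoothFamily (n := n) f) : SmoothFamily (n := n) fun q x => A *ᵥ f q x :=
  hf.clm (LinearMap.toContinuousLinearMap A.mulVecLin)

theorem SmoothConfig.family {f : M → W} (hf : SmoothConfig (n := n) f) :
    SmoothFamily (n := n) fun _ : P => f :=
  ContMDiff.comp (g := f) (f := fun q : P × M => q.2) hf contMDiff_snd

theorem SmoothFamily.config {f : P → M → W} (hf : SmoothFamily (n := n) f) (q : P) :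
    SmoothConfig (n := n) (f q) :=
  ContMDiff.comp (g := fun q : P × M => f q.1 q.2) (f := fun x : M => (q, x)) hf
    (contMDiff_const.prodMk contMDiff_id)

theorem SmoothFamily.contDiff {f : P → M → W} (hf : SmoothFamily (n := n) f) (x : M) :
    ContDiff ℝ ∞ fun q => f q x :=
  (ContMDiff.comp (g := fun q : P × M => f q.1 q.2) (f := fun q : P => (q, x)) hf
    (contMDiff_id.prodMk contMDiff_const)).contDiff

theorem SmoothFamily.continuous {f : P → M → W} (hf : SmoothFamily (n := n) f) :
    Continuous fun q : P × M => f q.1 q.2 :=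
  ContMDiff.continuous hf

/-- The manifold derivative of the family `p ↦ f p x` is taken at `p = q`, with `(q, x)` as
parameter; tangent coordinates are trivial in normed spaces. -/
theorem SmoothFamily.fderiv [IsManifold (𝓡∂ n) ∞ M] {f : P → M → W}
    (hf : SmoothFamily (n := n) f) :
    SmoothFamily (n := n) fun q x => fderiv ℝ (fun q => f q x) q := by
  intro q₀
  have h := ContMDiffAt.mfderiv (I := 𝓘(ℝ, P)) (I' := 𝓘(ℝ, W)) (J := 𝓘(ℝ, P).prod (𝓡∂ n))
    (m := ∞) (n := ∞) (x₀ := q₀)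
    (fun (q : P × M) (p : P) => f p q.2) (fun q : P × M => q.1) (by
      have := ContMDiff.comp (I := (𝓘(ℝ, P).prod (𝓡∂ n)).prod 𝓘(ℝ, P))
        (g := fun q : P × M => f q.1 q.2)
        (f := fun q : (P × M) × P => (q.2, q.1.2)) hf
        (contMDiff_snd.prodMk (contMDiff_snd.comp contMDiff_fst))
      exact this _) contMDiffAt_fst (by simp)
  erw [inTangentCoordinates_model_space] at h
  simpa only [mfderiv_eq_fderiv] using h

theorem SmoothFamily.deriv_snd [IsManifold (𝓡∂ n) ∞ M] {f : P × ℝ → M → W}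
    (hf : SmoothFamily (n := n) f) :
    SmoothFamily (n := n) fun (q : P × ℝ) x => deriv (fun s => f (q.1, s) x) q.2 := by
  have h : SmoothFamily (n := n)
      fun (q : P × ℝ) x => _root_.fderiv ℝ (fun q => f q x) q ((0 : P), (1 : ℝ)) :=
    hf.fderiv.clm (ContinuousLinearMap.apply ℝ W ((0 : P), (1 : ℝ)))
  convert h using 3 with q x
  have h1 : HasFDerivAt (fun q => f q x) (_root_.fderiv ℝ (fun q => f q x) q) (q.1, q.2) :=
    ((hf.contDiff x).differentiable (by simp) q).hasFDerivAt
  have h2 : HasDerivAt (fun s : ℝ => (q.1, s)) ((0 : P), (1 : ℝ)) q.2 :=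
    (hasDerivAt_const _ _).prodMk (hasDerivAt_id _)
  exact (h1.comp_hasDerivAt q.2 h2).deriv

theorem SmoothFamily.deriv_at [IsManifold (𝓡∂ n) ∞ M] {f : P → ℝ → M → W}
    (hf : SmoothFamily (n := n) fun (q : P × ℝ) => f q.1 q.2) {s : P' → ℝ} {φ : P' → P}
    (hs : ContDiff ℝ ∞ s) (hφ : ContDiff ℝ ∞ φ) :
    SmoothFamily (n := n) fun q x => deriv (fun r => f (φ q) r x) (s q) :=
  (SmoothFamily.deriv_snd hf).comp (hφ.prodMk hs)

theorem SmoothFamily.differentiableAt {f : P → M → W} (hf : SmoothFamily (n := n) f) (x : M)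
    (q : P) : DifferentiableAt ℝ (fun q => f q x) q :=
  (hf.contDiff x).differentiable (by simp) q

theorem SmoothFamily.hasDerivAt {f : ℝ → M → W} (hf : SmoothFamily (n := n) f) (x : M)
    (s : ℝ) : HasDerivAt (fun s => f s x) (deriv (fun s => f s x) s) s :=
  (hf.differentiableAt x s).hasDerivAt

end Families

/-! ### Differentiation under the integral over a compact manifold. -/

section Integral

variable {n : ℕ} [NeZero n] {M : Type*} [TopologicalSpace M] [CompactSpace M]
  [ChartedSpace (EuclideanHalfSpace n) M] [MeasurableSpace M] [BorelSpace M]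
  {P : Type} [NormedAddCommGroup P] [NormedSpace ℝ P] [FiniteDimensional ℝ P]
  {W : Type} [NormedAddCommGroup W] [NormedSpace ℝ W]

omit [NormedSpace ℝ W] in
theorem _root_.Continuous.integrable_of_compactSpace {f : M → W} (hf : Continuous f) (μ : Measure M)
    [IsFiniteMeasure μ] : Integrable f μ :=
  hf.integrable_of_hasCompactSupport (HasCompactSupport.of_compactSpace f)

theorem SmoothConfig.integrable {f : M → W} (hf : SmoothConfig (n := n) f) (μ : Measure M)
    [IsFiniteMeasure μ] : Integrable f μ :=
  (ContMDiff.continuous hf).integrable_of_compactSpace μ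

variable [IsManifold (𝓡∂ n) ∞ M]

/-- The derivative is bounded on the compact set `closedBall q 1 × M`; a constant dominates because
the measure is finite. -/
theorem SmoothFamily.hasFDerivAt_integral {f : P → M → W} (hf : SmoothFamily (n := n) f)
    (μ : Measure M) [IsFiniteMeasure μ] (q : P) :
    HasFDerivAt (fun q => ∫ x, f q x ∂μ) (∫ x, _root_.fderiv ℝ (fun q => f q x) q ∂μ) q := by
  have hcont := hf.fderiv.continuous
  obtain ⟨C, hC⟩ := ((isCompact_closedBall q 1).prod isCompact_univ).exists_bound_of_continuousOn
    (hcont.continuousOn (s := Metric.closedBall q 1 ×ˢ (Set.univ : Set M)))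
  refine hasFDerivAt_integral_of_dominated_of_fderiv_le (bound := fun _ => C)
    (F' := fun q x => _root_.fderiv ℝ (fun q => f q x) q)
    (Metric.closedBall_mem_nhds q one_pos) ?_ ((hf.config q).integrable μ)
    ((hf.fderiv.config q).integrable μ).aestronglyMeasurable ?_ (integrable_const C) ?_
  · exact Filter.Eventually.of_forall fun p => ((hf.config p).integrable μ).aestronglyMeasurable
  · exact Filter.Eventually.of_forall fun x p hp => hC (p, x) ⟨hp, Set.mem_univ _⟩
  · exact Filter.Eventually.of_forall fun x p _ => (hf.differentiableAt x p).hasFDerivAt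

/-- The target is quantified inside the induction because each step replaces `W` by `P →L[ℝ] W`;
having `P` and `W` in `Type` keeps the universe fixed. -/
theorem SmoothFamily.contDiff_integral_nat (μ : Measure M) [IsFiniteMeasure μ] (k : ℕ) :
    ∀ {W : Type} [NormedAddCommGroup W] [NormedSpace ℝ W] {f : P → M → W},
      SmoothFamily (n := n) f → ContDiff ℝ k fun q => ∫ x, f q x ∂μ := by
  induction k with
  | zero =>
    intro W _ _ f hf
    have : Continuous fun q => ∫ x, f q x ∂μ :=
      continuous_iff_continuousAt.2 fun q => (hf.hasFDerivAt_integral μ q).continuousAt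
    exact contDiff_zero.2 this
  | succ k ih =>
    intro W _ _ f hf
    have hd : (_root_.fderiv ℝ fun q => ∫ x, f q x ∂μ) =
        fun q => ∫ x, _root_.fderiv ℝ (fun q => f q x) q ∂μ :=
      funext fun q => (hf.hasFDerivAt_integral μ q).fderiv
    rw [Nat.cast_add, Nat.cast_one, contDiff_succ_iff_fderiv]
    refine ⟨fun q => (hf.hasFDerivAt_integral μ q).differentiableAt, by simp, ?_⟩
    rw [hd]
    exact ih hf.fderiv

theorem SmoothFamily.contDiff_integral {f : P → M → W} (hf : SmoothFamily (n := n) f)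
    (μ : Measure M) [IsFiniteMeasure μ] : ContDiff ℝ ∞ fun q => ∫ x, f q x ∂μ :=
  contDiff_infty.2 fun k => SmoothFamily.contDiff_integral_nat μ k hf

theorem SmoothFamily.hasDerivAt_integral [CompleteSpace W] {f : ℝ → M → W}
    (hf : SmoothFamily (n := n) f)
    (μ : Measure M) [IsFiniteMeasure μ] (s : ℝ) :
    HasDerivAt (fun s => ∫ x, f s x ∂μ) (∫ x, deriv (fun s => f s x) s ∂μ) s := by
  have h := (hf.hasFDerivAt_integral μ s).hasDerivAt
  rw [ContinuousLinearMap.integral_apply ((hf.fderiv.config s).integrable μ)] at h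
  simpa only [fderiv_apply_one_eq_deriv] using h

end Integral

/-! ### Symmetry of second derivatives. -/

section Mixed

variable {W : Type*} [NormedAddCommGroup W] [NormedSpace ℝ W]

/-- The mixed partial derivatives of a smooth function of two real variables agree. -/
theorem deriv_deriv_comm {f : ℝ × ℝ → W} (hf : ContDiff ℝ ∞ f) (a b : ℝ) :
    deriv (fun s => deriv (fun t => f (s, t)) b) a =
      deriv (fun t => deriv (fun s => f (s, t)) a) b := by
  have hd : Differentiable ℝ f := hf.differentiable (by simp)
  have hd' : Differentiable ℝ (fderiv ℝ f) :=
    (hf.fderiv_right (m := ∞) (by simp)).differentiable (by simp)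
  have e1 : ∀ s t : ℝ, deriv (fun t => f (s, t)) t = fderiv ℝ f (s, t) (0, 1) := fun s t =>
    ((hd (s, t)).hasFDerivAt.comp_hasDerivAt t
      ((hasDerivAt_const _ _).prodMk (hasDerivAt_id _))).deriv
  have e2 : ∀ s t : ℝ, deriv (fun s => f (s, t)) s = fderiv ℝ f (s, t) (1, 0) := fun s t =>
    ((hd (s, t)).hasFDerivAt.comp_hasDerivAt s
      ((hasDerivAt_id _).prodMk (hasDerivAt_const _ _))).deriv
  simp only [e1, e2]
  have e3 : HasDerivAt (fun s : ℝ => fderiv ℝ f (s, b) (0, 1))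
      (fderiv ℝ (fderiv ℝ f) (a, b) (1, 0) (0, 1)) a := by
    have h : HasDerivAt (fun s : ℝ => fderiv ℝ f (s, b)) (fderiv ℝ (fderiv ℝ f) (a, b) (1, 0)) a :=
      (hd' (a, b)).hasFDerivAt.comp_hasDerivAt a
        ((hasDerivAt_id _).prodMk (hasDerivAt_const _ _))
    simpa using h.clm_apply (hasDerivAt_const a ((0 : ℝ), (1 : ℝ)))
  have e4 : HasDerivAt (fun t : ℝ => fderiv ℝ f (a, t) (1, 0))
      (fderiv ℝ (fderiv ℝ f) (a, b) (0, 1) (1, 0)) b := by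
    have h : HasDerivAt (fun t : ℝ => fderiv ℝ f (a, t)) (fderiv ℝ (fderiv ℝ f) (a, b) (0, 1)) b :=
      (hd' (a, b)).hasFDerivAt.comp_hasDerivAt b
        ((hasDerivAt_const _ _).prodMk (hasDerivAt_id _))
    simpa using h.clm_apply (hasDerivAt_const b ((1 : ℝ), (0 : ℝ)))
  rw [e3.deriv, e4.deriv]
  exact (hf.contDiffAt.isSymmSndFDerivAt (by
    rw [minSmoothness_of_isRCLikeNormedField]; exact WithTop.coe_le_coe.2 le_top)) _ _

end Mixed

/-! ### Stationarity of spatial derivatives, on sets that may have a boundary. -/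

section Euclidean

variable {E F : Type*} [NormedAddCommGroup E] [NormedSpace ℝ E] [NormedAddCommGroup F]
  [NormedSpace ℝ F] {S : Set E}

theorem fderivWithin_univ_prod_inr {g : ℝ × E → F} (hS : UniqueDiffOn ℝ S)
    (hg : DifferentiableOn ℝ g (Set.univ ×ˢ S)) (s : ℝ) {y : E} (hy : y ∈ S) :
    fderivWithin ℝ (fun y => g (s, y)) S y =
      (fderivWithin ℝ g (Set.univ ×ˢ S) (s, y)).comp (ContinuousLinearMap.inr ℝ ℝ E) := by
  refine HasFDerivWithinAt.fderivWithin ?_ (hS y hy)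
  exact (hg (s, y) ⟨Set.mem_univ _, hy⟩).hasFDerivWithinAt.comp y
    (hasFDerivAt_prodMk_right s y).hasFDerivWithinAt fun z hz => ⟨Set.mem_univ _, hz⟩

theorem hasDerivAt_univ_prod {g : ℝ × E → F}
    (hg : DifferentiableOn ℝ g (Set.univ ×ˢ S)) (s : ℝ) {y : E} (hy : y ∈ S) :
    HasDerivAt (fun s => g (s, y)) (fderivWithin ℝ g (Set.univ ×ˢ S) (s, y) (1, 0)) s := by
  rw [← hasDerivWithinAt_univ]
  have hm : Set.MapsTo (fun s : ℝ => (s, y)) Set.univ (Set.univ ×ˢ S) :=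
    fun z _ => ⟨Set.mem_univ _, hy⟩
  exact (hg (s, y) ⟨Set.mem_univ _, hy⟩).hasFDerivWithinAt.comp_hasDerivWithinAt s
    ((hasDerivAt_id s).prodMk (hasDerivAt_const s y)).hasDerivWithinAt hm

/-- A curve of functions with vanishing velocity at the parameter `0` has a curve of spatial
derivatives with the same property. -/
theorem contDiffOn_fderivWithin_snd {g : ℝ × E → F} (hS : UniqueDiffOn ℝ S)
    (hS' : S ⊆ closure (interior S)) (hg : ContDiffOn ℝ ∞ g (Set.univ ×ˢ S))
    (h0 : ∀ y ∈ S, HasDerivAt (fun s => g (s, y)) 0 0) :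
    ContDiffOn ℝ ∞ (fun q : ℝ × E => fderivWithin ℝ (fun y => g (q.1, y)) S q.2)
        (Set.univ ×ˢ S) ∧
      ∀ y ∈ S, HasDerivAt (fun s => fderivWithin ℝ (fun y => g (s, y)) S y) 0 0 := by
  have hU : UniqueDiffOn ℝ ((Set.univ : Set ℝ) ×ˢ S) := uniqueDiffOn_univ.prod hS
  have hd : DifferentiableOn ℝ g (Set.univ ×ˢ S) := hg.differentiableOn (by simp)
  have hg' : ContDiffOn ℝ ∞ (fderivWithin ℝ g (Set.univ ×ˢ S)) (Set.univ ×ˢ S) :=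
    hg.fderivWithin hU (by simp)
  have hd' := hg'.differentiableOn (by simp)
  have h1 : ContDiffOn ℝ ∞ (fun q : ℝ × E => (fderivWithin ℝ g (Set.univ ×ˢ S) q).comp
      (ContinuousLinearMap.inr ℝ ℝ E)) (Set.univ ×ˢ S) := hg'.clm_comp contDiffOn_const
  refine ⟨h1.congr fun q hq => fderivWithin_univ_prod_inr hS hd q.1 hq.2, fun y hy => ?_⟩
  have hfun : (fun s => fderivWithin ℝ (fun y => g (s, y)) S y) = fun s =>
      (fderivWithin ℝ g (Set.univ ×ˢ S) (s, y)).comp (ContinuousLinearMap.inr ℝ ℝ E) :=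
    funext fun s => fderivWithin_univ_prod_inr hS hd s hy
  rw [hfun]
  have h2 := (hasDerivAt_univ_prod hd' 0 hy).clm_comp
    (hasDerivAt_const (0 : ℝ) (ContinuousLinearMap.inr ℝ ℝ E))
  convert h2 using 1
  ext v
  -- Second derivatives within a set are symmetric at limits of interior points, which covers
  -- boundary points of the half-space.
  have hmem : ((0 : ℝ), y) ∈ closure (interior ((Set.univ : Set ℝ) ×ˢ S)) := by
    rw [interior_prod_eq, interior_univ, closure_prod_eq, closure_univ]
    exact ⟨Set.mem_univ _, hS' hy⟩
  have hsymm := (hg (0, y) ⟨Set.mem_univ _, hy⟩).isSymmSndFDerivWithinAt (by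
    rw [minSmoothness_of_isRCLikeNormedField]; exact WithTop.coe_le_coe.2 le_top) hU hmem
    ⟨Set.mem_univ _, hy⟩
  have h3 := fderivWithin_univ_prod_inr hS hd' 0 hy
  -- The parameter derivative at `0` vanishes on all of `S`, hence so does its spatial derivative;
  -- symmetry exchanges the two.
  have h4 : HasFDerivWithinAt
      (fun y => fderivWithin ℝ g (Set.univ ×ˢ S) ((0 : ℝ), y) ((1 : ℝ), (0 : E)))
      (0 : E →L[ℝ] F) S y :=
    (hasFDerivWithinAt_const (0 : F) y S).congr
      (fun z hz => (hasDerivAt_univ_prod hd 0 hz).unique (h0 z hz))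
      ((hasDerivAt_univ_prod hd 0 hy).unique (h0 y hy))
  have h5 : HasFDerivWithinAt (fun y => fderivWithin ℝ g (Set.univ ×ˢ S) ((0 : ℝ), y))
      ((fderivWithin ℝ (fderivWithin ℝ g (Set.univ ×ˢ S)) (Set.univ ×ˢ S) (0, y)).comp
        (ContinuousLinearMap.inr ℝ ℝ E)) S y :=
    (hd' (0, y) ⟨Set.mem_univ _, hy⟩).hasFDerivWithinAt.comp y
      (hasFDerivAt_prodMk_right (0 : ℝ) y).hasFDerivWithinAt fun z hz => ⟨Set.mem_univ _, hz⟩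
  have h6 := h5.clm_apply (hasFDerivWithinAt_const ((1 : ℝ), (0 : E)) y S)
  have h7 := DFunLike.congr_fun ((hS y hy).eq h4 h6) v
  have h8 := hsymm ((1 : ℝ), (0 : E)) ((0 : ℝ), v)
  simp at h7 ⊢
  rw [h8, ← h7]

/-- Smoothness and stationarity are proved together since each induction step needs both; iterated
derivatives differ from derivatives of derivatives only by a linear currying isometry. -/
theorem contDiffOn_iteratedFDerivWithin_snd {g : ℝ × E → F} (hS : UniqueDiffOn ℝ S)
    (hS' : S ⊆ closure (interior S)) (hg : ContDiffOn ℝ ∞ g (Set.univ ×ˢ S))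
    (h0 : ∀ y ∈ S, HasDerivAt (fun s => g (s, y)) 0 0) (j : ℕ) :
    ContDiffOn ℝ ∞ (fun q : ℝ × E => iteratedFDerivWithin ℝ j (fun y => g (q.1, y)) S q.2)
        (Set.univ ×ˢ S) ∧
      ∀ y ∈ S, HasDerivAt (fun s => iteratedFDerivWithin ℝ j (fun y => g (s, y)) S y) 0 0 := by
  induction j with
  | zero =>
    let L : F →L[ℝ] E [×0]→L[ℝ] F :=
      (continuousMultilinearCurryFin0 ℝ E F).symm.toContinuousLinearEquiv.toContinuousLinearMap
    have e : ∀ q : ℝ × E, iteratedFDerivWithin ℝ 0 (fun y => g (q.1, y)) S q.2 = L (g q) :=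
      fun _ => rfl
    refine ⟨(L.contDiff.comp_contDiffOn hg).congr fun q _ => e q, fun y hy => ?_⟩
    have h := L.hasFDerivAt.comp_hasDerivAt (0 : ℝ) (h0 y hy)
    rw [map_zero] at h
    exact h.congr_of_eventuallyEq (Filter.Eventually.of_forall fun s => e (s, y))
  | succ j ih =>
    let L := (continuousMultilinearCurryLeftEquiv ℝ (fun _ : Fin (j + 1) => E) F).symm
    have e : ∀ q : ℝ × E, iteratedFDerivWithin ℝ (j + 1) (fun y => g (q.1, y)) S q.2 =
        L (fderivWithin ℝ (fun y => iteratedFDerivWithin ℝ j (fun y => g (q.1, y)) S y) S q.2) :=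
      fun _ => rfl
    obtain ⟨h1, h2⟩ := contDiffOn_fderivWithin_snd
      (g := fun q : ℝ × E => iteratedFDerivWithin ℝ j (fun y => g (q.1, y)) S q.2) hS hS' ih.1 ih.2
    have h3 := L.contDiff.comp_contDiffOn (n := ∞) h1
    refine ⟨h3.congr fun q _ => e q, fun y hy => ?_⟩
    have h := L.toContinuousLinearEquiv.hasFDerivAt.comp_hasDerivAt (0 : ℝ) (h2 y hy)
    rw [map_zero] at h
    exact h.congr_of_eventuallyEq (Filter.Eventually.of_forall fun s => e (s, y))

end Euclidean

/-! ### Reduction of local functions to finitely many variables through jets. -/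

section Jets

theorem finiteDimensional_continuousMultilinearMap (n m j : ℕ) :
    FiniteDimensional ℝ ((EuclideanSpace ℝ (Fin n)) [×j]→L[ℝ] (Fin m → ℝ)) :=
  FiniteDimensional.of_injective
    (ContinuousMultilinearMap.toMultilinearMapLinear :
      ((EuclideanSpace ℝ (Fin n)) [×j]→L[ℝ] (Fin m → ℝ)) →ₗ[ℝ] _)
    ContinuousMultilinearMap.toMultilinearMap_injective

variable {n : ℕ} [NeZero n] {m : ℕ} {M : Type*} [TopologicalSpace M]
  [ChartedSpace (EuclideanHalfSpace n) M] {W : Type*} [NormedAddCommGroup W] [NormedSpace ℝ W]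

/-- The field `smooth` tests Euclidean parameter spaces only; `toEuclidean` carries it to any
finite-dimensional one. -/
theorem LocalOp.smoothFamily (P : LocalOp n m M W) {V : Type*} [NormedAddCommGroup V]
    [NormedSpace ℝ V] [FiniteDimensional ℝ V] {f : V → M → (Fin m → ℝ)}
    (hf : SmoothFamily (n := n) f) :
    SmoothFamily (n := n) fun (q : ℝ × V) => P.toFun q.1 (f q.2) := by
  have h := P.smooth _ _ (hf.comp (toEuclidean (E := V)).symm.contDiff)
  have h2 := h.comp (φ := fun q : ℝ × V => (q.1, toEuclidean q.2))
    (contDiff_fst.prodMk ((toEuclidean (E := V)).contDiff.comp contDiff_snd))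
  simpa using h2

/-- The space of `k`-jets in a chart. -/
abbrev JetSpace (n m k : ℕ) : Type :=
  (j : Fin (k + 1)) → ((EuclideanSpace ℝ (Fin n)) [×(j : ℕ)]→L[ℝ] (Fin m → ℝ))

instance (n m k : ℕ) : FiniteDimensional ℝ (JetSpace n m k) :=
  haveI := fun j : Fin (k + 1) => finiteDimensional_continuousMultilinearMap n m j
  inferInstance

/-- The vector space of smooth configurations. -/
def configSubmodule (n : ℕ) [NeZero n] (m : ℕ) (M : Type*) [TopologicalSpace M]
    [ChartedSpace (EuclideanHalfSpace n) M] : Submodule ℝ (M → (Fin m → ℝ)) where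
  carrier := {f | SmoothConfig (n := n) f}
  add_mem' hf hg := ContMDiff.add hf hg
  zero_mem' := contMDiff_const
  smul_mem' c _ hf := (contMDiff_const (c := c) : ContMDiff (𝓡∂ n) 𝓘(ℝ, ℝ) ∞ fun _ : M => c).smul hf

variable [IsManifold (𝓡∂ n) ∞ M]

theorem SmoothFamily.contDiffOn_chart {P : Type*} [NormedAddCommGroup P] [NormedSpace ℝ P]
    {f : P → M → W} (hf : SmoothFamily (n := n) f) (x : M) :
    ContDiffOn ℝ ∞ (fun q : P × EuclideanSpace ℝ (Fin n) => f q.1 ((extChartAt (𝓡∂ n) x).symm q.2))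
      (Set.univ ×ˢ (extChartAt (𝓡∂ n) x).target) := by
  rw [← contMDiffOn_iff_contDiffOn]
  have h1 : ContMDiffOn 𝓘(ℝ, P × EuclideanSpace ℝ (Fin n)) (𝓡∂ n) ∞
      (fun q : P × EuclideanSpace ℝ (Fin n) => (extChartAt (𝓡∂ n) x).symm q.2)
      (Set.univ ×ˢ (extChartAt (𝓡∂ n) x).target) :=
    (contMDiffOn_extChartAt_symm (n := ∞) x).comp contDiff_snd.contMDiff.contMDiffOn
      fun q hq => hq.2
  exact ContMDiff.comp_contMDiffOn (g := fun q : P × M => f q.1 q.2) hf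
    (contDiff_fst.contMDiff.contMDiffOn.prodMk h1)

theorem SmoothConfig.contDiffOn_chart {f : M → W} (hf : SmoothConfig (n := n) f) (x : M) :
    ContDiffOn ℝ ∞ (f ∘ (extChartAt (𝓡∂ n) x).symm) (extChartAt (𝓡∂ n) x).target := by
  rw [← contMDiffOn_iff_contDiffOn]
  exact ContMDiff.comp_contMDiffOn (g := f) hf (contMDiffOn_extChartAt_symm (n := ∞) x)

omit [IsManifold (𝓡∂ n) ∞ M] in
theorem iteratedFDerivWithin_range_eq_target (f : EuclideanSpace ℝ (Fin n) → W) (x : M) (j : ℕ) :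
    iteratedFDerivWithin ℝ j f (Set.range (𝓡∂ n)) (extChartAt (𝓡∂ n) x x) =
      iteratedFDerivWithin ℝ j f (extChartAt (𝓡∂ n) x).target (extChartAt (𝓡∂ n) x x) := by
  have h : (Set.range (𝓡∂ n)) =ᶠ[nhds (extChartAt (𝓡∂ n) x x)] (extChartAt (𝓡∂ n) x).target :=
    nhdsWithin_eq_iff_eventuallyEq.1 (nhdsWithin_extChartAt_target_eq x).symm
  exact iteratedFDerivWithin_congr_set h j

omit [IsManifold (𝓡∂ n) ∞ M] in
theorem smoothConfig_coe (f : configSubmodule n m M) : SmoothConfig (n := n) f.1 := f.2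

/-- The `k`-jet at `x` as a linear map on smooth configurations. -/
noncomputable def jetMap (m k : ℕ) (x : M) : configSubmodule n m M →ₗ[ℝ] JetSpace n m k where
  toFun f j := iteratedFDerivWithin ℝ j (f.1 ∘ (extChartAt (𝓡∂ n) x).symm)
    (extChartAt (𝓡∂ n) x).target (extChartAt (𝓡∂ n) x x)
  map_add' f g := by
    funext j
    exact iteratedFDerivWithin_add_apply
      ((((smoothConfig_coe f).contDiffOn_chart x) _ (mem_extChartAt_target x)).of_le
        (WithTop.coe_le_coe.2 le_top))
      ((((smoothConfig_coe g).contDiffOn_chart x) _ (mem_extChartAt_target x)).of_le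
        (WithTop.coe_le_coe.2 le_top))
      (uniqueDiffOn_extChartAt_target x) (mem_extChartAt_target x)
  map_smul' c f := by
    funext j
    exact iteratedFDerivWithin_const_smul_apply
      ((((smoothConfig_coe f).contDiffOn_chart x) _ (mem_extChartAt_target x)).of_le
        (WithTop.coe_le_coe.2 le_top))
      (uniqueDiffOn_extChartAt_target x) (mem_extChartAt_target x)

theorem sameJet_of_jetMap_eq {k : ℕ} {x : M} {f g : configSubmodule n m M}
    (h : jetMap m k x f = jetMap m k x g) : SameJet (n := n) k f.1 g.1 x := by
  intro j hj
  rw [iteratedFDerivWithin_range_eq_target, iteratedFDerivWithin_range_eq_target]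
  exact congrFun h ⟨j, Nat.lt_succ_of_le hj⟩

/-- Applied to the jet map at a point, `K` realises every attained jet by a global smooth
configuration depending linearly on it. -/
theorem _root_.LinearMap.exists_generalizedInverse {V U : Type*} [AddCommGroup V] [Module ℝ V]
    [AddCommGroup U] [Module ℝ U] (J : V →ₗ[ℝ] U) : ∃ K : U →ₗ[ℝ] V, ∀ v, J (K (J v)) = J v := by
  obtain ⟨g, hg⟩ := J.rangeRestrict.exists_rightInverse_of_surjective J.range_rangeRestrict
  obtain ⟨K, hK⟩ := g.exists_extend
  refine ⟨K, fun v => ?_⟩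
  have h1 : K (J v) = g (J.rangeRestrict v) := LinearMap.congr_fun hK (J.rangeRestrict v)
  rw [h1]
  exact congrArg Subtype.val (LinearMap.congr_fun hg (J.rangeRestrict v))

omit [IsManifold (𝓡∂ n) ∞ M] in
theorem smoothFamily_linear {V : Type*} [NormedAddCommGroup V] [NormedSpace ℝ V]
    [FiniteDimensional ℝ V] (K : V →ₗ[ℝ] configSubmodule n m M) :
    SmoothFamily (n := n) fun v => (K v).1 := by
  let b := Module.finBasis ℝ V
  have e : (fun v => (K v).1) = fun v => ∑ i, b.repr v i • (K (b i)).1 := by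
    funext v
    conv_lhs => rw [← b.sum_repr v, map_sum]
    simp only [map_smul, Submodule.coe_sum, Submodule.coe_smul]
  rw [e]
  have h : ∀ i, SmoothFamily (n := n) fun v => b.repr v i • (K (b i)).1 := fun i =>
    SmoothFamily.param_smul (LinearMap.toContinuousLinearMap (b.coord i)).contDiff
      (smoothConfig_coe (K (b i))).family
  have h2 := ContMDiff.sum (t := Finset.univ) fun i _ => h i
  unfold SmoothFamily
  simpa [Finset.sum_apply] using h2

/-- Local functions are stationary along smooth curves of configurations with zero velocity. -/
theorem LocalOp.hasDerivAt_zero (P : LocalOp n m M W) (t : ℝ) {c : ℝ → M → (Fin m → ℝ)}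
    (hc : SmoothFamily (n := n) c) (h0 : ∀ x, deriv (fun s => c s x) 0 = 0) (x : M) :
    HasDerivAt (fun s => P.toFun t (c s) x) 0 0 := by
  let cc : ℝ → configSubmodule n m M := fun s => ⟨c s, hc.config s⟩
  let J : configSubmodule n m M →ₗ[ℝ] JetSpace n m P.order := jetMap m P.order x
  obtain ⟨K, hK⟩ := J.exists_generalizedInverse
  have hφ : SmoothFamily (n := n) fun v : JetSpace n m P.order => (cc 0 + K v).1 :=
    (SmoothConfig.family (hc.config 0)).add (smoothFamily_linear K)
  have hQ : Differentiable ℝ fun v : JetSpace n m P.order => P.toFun t (cc 0 + K v).1 x :=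
    ((((P.smoothFamily hφ).comp (contDiff_const.prodMk contDiff_id)).contDiff x).differentiable
      (by simp) : Differentiable ℝ fun v => P.toFun t (cc 0 + K v).1 x)
  -- As `J ∘ K ∘ J = J`, replacing `c s` by this configuration keeps its jet at `x`. The value at
  -- `x` is now a differentiable function on the finite-dimensional jet space, where the ordinary
  -- chain rule applies.
  have e : ∀ s, P.toFun t (c s) x = P.toFun t (cc 0 + K (J (cc s - cc 0))).1 x := by
    intro s
    refine P.jet t _ _ x (cc s).2 (cc 0 + K (J (cc s - cc 0))).2 (sameJet_of_jetMap_eq (f := cc s) ?_)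
    change J _ = J _
    rw [map_add, hK, map_sub, add_sub_cancel]
  have hJ : HasDerivAt (fun s => J (cc s - cc 0)) 0 0 := by
    have h1 : HasDerivAt (fun s => J (cc s)) 0 0 := by
      rw [hasDerivAt_pi]
      intro j
      exact (contDiffOn_iteratedFDerivWithin_snd (uniqueDiffOn_extChartAt_target x)
        extChartAt_target_subset_closure_interior (hc.contDiffOn_chart x)
        (fun y _ => by
          have := hc.hasDerivAt ((extChartAt (𝓡∂ n) x).symm y) 0
          rwa [h0] at this) j).2 _ (mem_extChartAt_target x)
    simpa only [map_sub] using h1.sub_const (J (cc 0))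
  have h := (hQ (J (cc 0 - cc 0))).hasFDerivAt.comp_hasDerivAt (0 : ℝ) hJ
  rw [map_zero] at h
  exact h.congr_of_eventuallyEq (Filter.Eventually.of_forall e)

end Jets

/-! ### The two-variable chain rule. -/

section Calculus

variable {W : Type*} [NormedAddCommGroup W] [NormedSpace ℝ W]

theorem deriv_comp_prodMk {F : ℝ × ℝ → W} (hF : ContDiff ℝ ∞ F) {φ ψ : ℝ → ℝ} {a b s : ℝ}
    (hφ : HasDerivAt φ a s) (hψ : HasDerivAt ψ b s) :
    deriv (fun r => F (φ r, ψ r)) s =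
      a • deriv (fun r => F (r, ψ s)) (φ s) + b • deriv (fun r => F (φ s, r)) (ψ s) := by
  have hd := (hF.differentiable (by simp) (φ s, ψ s)).hasFDerivAt
  have e0 := (hd.comp_hasDerivAt s (hφ.prodMk hψ)).deriv
  have e1 : deriv (fun r => F (r, ψ s)) (φ s) = fderiv ℝ F (φ s, ψ s) (1, 0) :=
    (hd.comp_hasDerivAt (φ s) ((hasDerivAt_id _).prodMk (hasDerivAt_const _ _))).deriv
  have e2 : deriv (fun r => F (φ s, r)) (ψ s) = fderiv ℝ F (φ s, ψ s) (0, 1) :=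
    (hd.comp_hasDerivAt (ψ s) ((hasDerivAt_const _ _).prodMk (hasDerivAt_id _))).deriv
  rw [e1, e2, ← map_smul, ← map_smul, ← map_add]
  simpa [Function.comp_def] using e0

end Calculus

/-! ### Locality in space. -/

section LocalOps

variable {n : ℕ} [NeZero n] {m : ℕ} {M : Type*} [TopologicalSpace M]
  [ChartedSpace (EuclideanHalfSpace n) M] {W : Type*} [NormedAddCommGroup W] [NormedSpace ℝ W]

/-- A constant matrix applied to the values of a local function. -/
def LocalOp.matrix (A : Matrix (Fin m) (Fin m) ℝ) (P : LocalOp n m M (Fin m → ℝ)) :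
    LocalOp n m M (Fin m → ℝ) where
  toFun t z x := A *ᵥ P.toFun t z x
  order := P.order
  jet t f g x hf hg h := congrArg (A *ᵥ ·) (P.jet t f g x hf hg h)
  smooth p f hf := (P.smooth p f hf).mulVec A

/-- A local function with the explicit time dependence frozen. -/
def LocalOp.freeze (P : LocalOp n m M W) (t : ℝ) : LocalOp n m M W where
  toFun _ z x := P.toFun t z x
  order := P.order
  jet _ f g x hf hg h := P.jet t f g x hf hg h
  smooth p f hf := (P.smooth p f hf).comp (φ := fun q : ℝ × EuclideanSpace ℝ (Fin p) => (t, q.2))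
    (contDiff_const.prodMk contDiff_snd)

theorem SameJet.of_eqOn {k : ℕ} {f g : M → W} {U : Set M} (hU : IsOpen U)
    (h : ∀ x ∈ U, f x = g x) {x : M} (hx : x ∈ U) : SameJet (n := n) k f g x := by
  intro j _
  have h1 : ∀ᶠ y in nhds (extChartAt (𝓡∂ n) x x), (extChartAt (𝓡∂ n) x).symm y ∈ U :=
    (continuousAt_extChartAt_symm (I := 𝓡∂ n) x).eventually_mem (by
      rw [extChartAt_to_inv]; exact hU.mem_nhds hx)
  have h2 : f ∘ (extChartAt (𝓡∂ n) x).symm =ᶠ[nhds (extChartAt (𝓡∂ n) x x)]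
      g ∘ (extChartAt (𝓡∂ n) x).symm := h1.mono fun y hy => h _ hy
  exact (h2.filter_mono nhdsWithin_le_nhds).iteratedFDerivWithin_eq h2.eq_of_nhds j

theorem LocalOp.eq_of_eqOn (P : LocalOp n m M W) (t : ℝ) {f g : M → (Fin m → ℝ)}
    (hf : SmoothConfig (n := n) f) (hg : SmoothConfig (n := n) g) {U : Set M} (hU : IsOpen U)
    (h : ∀ x ∈ U, f x = g x) {x : M} (hx : x ∈ U) : P.toFun t f x = P.toFun t g x :=
  P.jet t f g x hf hg (SameJet.of_eqOn hU h hx)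

end LocalOps

/-! ### Operators on histories: chain rule, total time derivative and variations. -/

section HistoryOps

variable {n : ℕ} [NeZero n] {m : ℕ} {M : Type*} [TopologicalSpace M]
  [ChartedSpace (EuclideanHalfSpace n) M] {W : Type*} [NormedAddCommGroup W] [NormedSpace ℝ W]

/-- Families of time dependent maps, smooth jointly in the parameter, the time and the point. -/
def SmoothHistories (n : ℕ) [NeZero n] [ChartedSpace (EuclideanHalfSpace n) M] {P : Type*}
    [NormedAddCommGroup P] [NormedSpace ℝ P] (f : P → ℝ → M → W) : Prop :=
  SmoothFamily (n := n) fun (q : P × ℝ) => f q.1 q.2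

variable {P : Type*} [NormedAddCommGroup P] [NormedSpace ℝ P]
  {P' : Type*} [NormedAddCommGroup P'] [NormedSpace ℝ P']

theorem SmoothHistories.comp {f : P → ℝ → M → W} (hf : SmoothHistories n f) {φ : P' → P}
    (hφ : ContDiff ℝ ∞ φ) : SmoothHistories n fun q => f (φ q) :=
  SmoothFamily.comp (φ := fun q : P' × ℝ => (φ q.1, q.2)) hf
    ((hφ.comp contDiff_fst).prodMk contDiff_snd)

theorem SmoothHistories.time {f : P → ℝ → M → W} (hf : SmoothHistories n f) (t : ℝ) :
    SmoothFamily (n := n) fun q => f q t :=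
  SmoothFamily.comp (φ := fun q : P => (q, t)) hf (contDiff_id.prodMk contDiff_const)

theorem SmoothHistories.history {f : P → ℝ → M → W} (hf : SmoothHistories n f) (q : P) :
    SmoothFamily (n := n) (f q) :=
  SmoothFamily.comp (φ := fun t : ℝ => (q, t)) hf (contDiff_const.prodMk contDiff_id)

theorem SmoothHistories.const {f : ℝ → M → W} (hf : SmoothFamily (n := n) f) :
    SmoothHistories n fun _ : P => f :=
  hf.comp contDiff_snd

theorem SmoothHistories.add {f g : P → ℝ → M → W} (hf : SmoothHistories n f)
    (hg : SmoothHistories n g) : SmoothHistories n fun q => f q + g q :=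
  SmoothFamily.add hf hg

theorem SmoothHistories.sub {f g : P → ℝ → M → W} (hf : SmoothHistories n f)
    (hg : SmoothHistories n g) : SmoothHistories n fun q => f q - g q :=
  SmoothFamily.sub hf hg

theorem SmoothHistories.smul {a : P → ℝ} (ha : ContDiff ℝ ∞ a) {f : P → ℝ → M → W}
    (hf : SmoothHistories n f) : SmoothHistories n fun q => a q • f q :=
  SmoothFamily.param_smul (a := fun q : P × ℝ => a q.1) (ha.comp contDiff_fst) hf

theorem SmoothHistories.line {z y : ℝ → M → W} (hz : SmoothFamily (n := n) z)
    (hy : SmoothFamily (n := n) y) : SmoothHistories n fun ε : ℝ => z + ε • y :=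
  (SmoothHistories.const hz).add (SmoothHistories.smul contDiff_id (SmoothHistories.const hy))

theorem SmoothHistories.deriv_param [IsManifold (𝓡∂ n) ∞ M] {f : P → ℝ → ℝ → M → W}
    (hf : SmoothHistories n fun (q : P × ℝ) => f q.1 q.2) (s : ℝ) :
    SmoothHistories n fun q t x => deriv (fun r => f q r t x) s := by
  have h : SmoothFamily (n := n) fun (q : (P × ℝ) × ℝ) => f q.1.1 q.2 q.1.2 :=
    SmoothFamily.comp (φ := fun q : (P × ℝ) × ℝ => ((q.1.1, q.2), q.1.2)) hf (by fun_prop)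
  exact SmoothFamily.deriv_at (f := fun (q : P × ℝ) r => f q.1 r q.2) h
    contDiff_const contDiff_id

theorem SmoothFamily.deriv_param [IsManifold (𝓡∂ n) ∞ M] {f : ℝ → ℝ → M → W}
    (hf : SmoothHistories n f) (s : ℝ) :
    SmoothFamily (n := n) fun t x => deriv (fun r => f r t x) s :=
  ((SmoothHistories.deriv_param (P := ℝ) (f := fun _ => f) (hf.comp contDiff_snd) s).history 0)

theorem SmoothFamily.velocity [IsManifold (𝓡∂ n) ∞ M] {z : History m M}
    (hz : SmoothFamily (n := n) z) : SmoothFamily (n := n) (velocity z) :=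
  SmoothFamily.deriv_at (P := ℝ) (f := fun _ => z) (hz.comp contDiff_snd) contDiff_id contDiff_id

/-- Operators on histories that are smooth, depend to first order only on the tangent of a curve
of histories, are local in space and equivariant under time translations. -/
structure SmoothOp (n : ℕ) [NeZero n] [ChartedSpace (EuclideanHalfSpace n) M]
    (D : History m M → ℝ → M → W) : Prop where
  smooth : ∀ (p : ℕ) (f : EuclideanSpace ℝ (Fin p) → History m M), SmoothHistories n f →
    SmoothHistories n fun q => D (f q)
  stationary : ∀ f : ℝ → History m M, SmoothHistories n f →
    (∀ t x, deriv (fun s => f s t x) 0 = 0) → ∀ t x, deriv (fun s => D (f s) t x) 0 = 0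
  eq_of_eqOn : ∀ z z' : History m M, SmoothFamily (n := n) z → SmoothFamily (n := n) z' →
    ∀ U : Set M, IsOpen U → (∀ t, ∀ x ∈ U, z t x = z' t x) → ∀ t, ∀ x ∈ U, D z t x = D z' t x
  shift : ∀ z : History m M, SmoothFamily (n := n) z → ∀ s t x,
    D (fun r => z (r + s)) t x = D z (t + s) x

theorem SmoothOp.smoothHistories {D : History m M → ℝ → M → W} (hD : SmoothOp n D)
    [FiniteDimensional ℝ P] {f : P → History m M} (hf : SmoothHistories n f) :
    SmoothHistories n fun q => D (f q) := by
  have h := hD.smooth _ _ (hf.comp (toEuclidean (E := P)).symm.contDiff)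
  simpa using h.comp (toEuclidean (E := P)).contDiff

theorem SmoothOp.apply {D : History m M → ℝ → M → W} (hD : SmoothOp n D)
    {z : History m M} (hz : SmoothFamily (n := n) z) : SmoothFamily (n := n) (D z) :=
  (hD.smoothHistories (SmoothHistories.const (P := ℝ) hz)).history 0

/-- The chain rule: the first order variation depends only on the tangent of the curve. -/
theorem SmoothOp.deriv_congr {D : History m M → ℝ → M → W} (hD : SmoothOp n D)
    {f g : ℝ → History m M} (hf : SmoothHistories n f) (hg : SmoothHistories n g)
    (h0 : f 0 = g 0) (h1 : ∀ t x, deriv (fun s => f s t x) 0 = deriv (fun s => g s t x) 0)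
    (t : ℝ) (x : M) : deriv (fun s => D (f s) t x) 0 = deriv (fun s => D (g s) t x) 0 := by
  -- On the axes this two-parameter family is `f` and `g`; along `(s, -s)` the tangents cancel, so
  -- stationarity equates the two partial derivatives.
  have hh : SmoothHistories n fun q : ℝ × ℝ => f q.1 + g q.2 - f 0 :=
    ((hf.comp contDiff_fst).add (hg.comp contDiff_snd)).sub (SmoothHistories.const (hf.history 0))
  have h2 := hD.stationary (fun s : ℝ => f s + g (-s) - f 0)
    (hh.comp (contDiff_id.prodMk contDiff_id.neg)) (fun t x => by
      have e1 := (hf.time t).hasDerivAt x 0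
      have e2 : HasDerivAt (fun s => g (-s) t x) (-deriv (fun s => g s t x) 0) 0 := by
        have := HasDerivAt.scomp (0 : ℝ) (h := fun s : ℝ => -s) (h' := -1)
          (g₁ := fun s => g s t x) (g₁' := deriv (fun s => g s t x) 0)
          (by simpa using (hg.time t).hasDerivAt x 0) (hasDerivAt_neg 0)
        simpa [Function.comp_def] using this
      have e3 := ((e1.add e2).sub_const (f 0 t x)).deriv
      rw [h1, add_neg_cancel] at e3
      exact e3) t x
  have h3 := deriv_comp_prodMk (((hD.smoothHistories hh).time t).contDiff x)
    (hasDerivAt_id (0 : ℝ)) (hasDerivAt_neg (0 : ℝ))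
  simp only [id_eq] at h3
  rw [h2] at h3
  simp only [neg_zero, ← h0, add_sub_cancel_right, add_sub_cancel_left, one_smul, neg_smul] at h3
  rw [eq_comm, add_neg_eq_zero] at h3
  exact h3

theorem LocalOp.smoothOp [IsManifold (𝓡∂ n) ∞ M] (Q : LocalOp n m M W) (hQ : Q.IsAutonomous) :
    SmoothOp n fun (z : History m M) t => Q.toFun t (z t) where
  smooth p _ hf := (Q.smoothFamily hf).comp
    (φ := fun q : EuclideanSpace ℝ (Fin p) × ℝ => (q.2, q)) (contDiff_snd.prodMk contDiff_id)
  stationary _ hf h0 t x := (Q.hasDerivAt_zero t (hf.time t) (h0 t) x).deriv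
  eq_of_eqOn _ _ hz hz' _ hU h t _ hx := Q.eq_of_eqOn t (hz.config t) (hz'.config t) hU (h t) hx
  shift z hz s t x := hQ t (t + s) (z (t + s)) (hz.config _) x

theorem SmoothOp.sub {D D' : History m M → ℝ → M → W} (hD : SmoothOp n D) (hD' : SmoothOp n D') :
    SmoothOp n (D - D') where
  smooth p f hf := (hD.smooth p f hf).sub (hD'.smooth p f hf)
  stationary f hf h0 t x := by
    have e1 := ((hD.smoothHistories hf).time t).hasDerivAt x 0
    have e2 := ((hD'.smoothHistories hf).time t).hasDerivAt x 0
    have e3 := (e1.sub e2).deriv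
    rw [hD.stationary f hf h0, hD'.stationary f hf h0, sub_zero] at e3
    exact e3
  eq_of_eqOn z z' hz hz' U hU h t x hx := by
    simp only [Pi.sub_apply, hD.eq_of_eqOn z z' hz hz' U hU h t x hx,
      hD'.eq_of_eqOn z z' hz hz' U hU h t x hx]
  shift z hz s t x := by simp only [Pi.sub_apply, hD.shift z hz, hD'.shift z hz]

variable [IsManifold (𝓡∂ n) ∞ M]

theorem SmoothOp.totalDt {D : HistoryOp m M} (hD : SmoothOp n D) : SmoothOp n (totalDt D) where
  smooth p f hf := SmoothFamily.deriv_snd (hD.smooth p f hf)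
  stationary f hf h0 t x := by
    have h := deriv_deriv_comm (SmoothFamily.contDiff (hD.smoothHistories hf) x) 0 t
    refine h.trans ?_
    simp only [hD.stationary f hf h0, deriv_const]
  eq_of_eqOn z z' hz hz' U hU h t x hx := by
    simp only [ExtSym.totalDt, fun s => hD.eq_of_eqOn z z' hz hz' U hU h s x hx]
  shift z hz s t x := by
    simp only [ExtSym.totalDt, hD.shift z hz]
    exact deriv_comp_add_const (fun r => D z r x) s t

omit [IsManifold (𝓡∂ n) ∞ M] in
theorem SmoothOp.smooth_vary_curve {D : HistoryOp m M} (hD : SmoothOp n D)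
    {X : History m M → History m M} (hX : SmoothOp n X) [FiniteDimensional ℝ P]
    {f : P → History m M} (hf : SmoothHistories n f) :
    SmoothHistories n fun q : P × ℝ => D (f q.1 + q.2 • X (f q.1)) :=
  hD.smoothHistories ((hf.comp contDiff_fst).add
    (SmoothHistories.smul contDiff_snd ((hX.smoothHistories hf).comp contDiff_fst)))

/-- Together with `SmoothOp.totalDt`, this places every `χ_E^k` in the class by induction. For
stationarity the two derivatives are exchanged: at fixed `ε`, the curve `f s + ε X (f s)` is itself
stationary. -/
theorem SmoothOp.vary {D : HistoryOp m M} (hD : SmoothOp n D)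
    {X : History m M → History m M} (hX : SmoothOp n X) : SmoothOp n (vary X D) where
  smooth p f hf := SmoothHistories.deriv_param (f := fun q ε => D (f q + ε • X (f q)))
    (hD.smooth_vary_curve hX hf) 0
  stationary f hf h0 t x := by
    have h := deriv_deriv_comm (((hD.smooth_vary_curve hX hf).time t).contDiff x) 0 0
    refine h.trans ?_
    have e : ∀ ε : ℝ, deriv (fun s => D (f s + ε • X (f s)) t x) 0 = 0 := fun ε => by
      refine hD.stationary _ (hf.add (SmoothHistories.smul contDiff_const
        (hX.smoothHistories hf))) (fun t x => ?_) t x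
      have e1 := (hf.time t).hasDerivAt x 0
      have e2 := ((hX.smoothHistories hf).time t).hasDerivAt x 0
      have e3 := (e1.add (e2.const_smul ε)).deriv
      rw [h0, hX.stationary f hf h0, smul_zero, add_zero] at e3
      exact e3
    simp only [e, deriv_const]
  eq_of_eqOn z z' hz hz' U hU h t x hx := by
    have e : ∀ ε : ℝ, D (z + ε • X z) t x = D (z' + ε • X z') t x := fun ε =>
      hD.eq_of_eqOn _ _ ((SmoothHistories.line hz (hX.apply hz)).history ε)
        ((SmoothHistories.line hz' (hX.apply hz')).history ε) U hU (fun t x hx => by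
          simp only [Pi.add_apply, Pi.smul_apply, h t x hx,
            hX.eq_of_eqOn z z' hz hz' U hU h t x hx]) t x hx
    simp only [ExtSym.vary, e]
  shift z hz s t x := by
    have e : ∀ ε : ℝ, D ((fun r => z (r + s)) + ε • X (fun r => z (r + s))) t x =
        D (z + ε • X z) (t + s) x := fun ε => by
      rw [← hD.shift _ ((SmoothHistories.line hz (hX.apply hz)).history ε)]
      congr 1
      funext r y
      simp only [Pi.add_apply, Pi.smul_apply, hX.shift z hz]
    simp only [ExtSym.vary, e]

/-- The curve of time translates of `z` has tangent `ż`, and equivariance turns the derivative of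
`D` along it into `d_t D`. -/
theorem SmoothOp.totalDt_eq_varyAt {D : HistoryOp m M} (hD : SmoothOp n D) {z : History m M}
    (hz : SmoothFamily (n := n) z) (t : ℝ) (x : M) :
    ExtSym.totalDt D z t x = varyAt (velocity z) D z t x := by
  have hs : SmoothHistories n fun s : ℝ => fun r => z (r + s) :=
    hz.comp (φ := fun q : ℝ × ℝ => q.2 + q.1) (by fun_prop)
  have h := hD.deriv_congr hs (SmoothHistories.line hz hz.velocity) (by simp) (fun t x => by
    have e1 : HasDerivAt (fun s : ℝ => z t x + s • velocity z t x) (velocity z t x) 0 := by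
      simpa using ((hasDerivAt_id (0 : ℝ)).smul_const (velocity z t x)).const_add (z t x)
    refine Eq.trans ?_ e1.deriv.symm
    rw [deriv_comp_const_add (fun r => z r x) t 0, add_zero]
    rfl) t x
  simp only [hD.shift z hz, deriv_comp_const_add (fun r => D z r x) t 0, add_zero] at h
  exact h

omit [IsManifold (𝓡∂ n) ∞ M] in
theorem SmoothOp.varyAt_sub {D : HistoryOp m M} (hD : SmoothOp n D) {z y y' : History m M}
    (hz : SmoothFamily (n := n) z) (hy : SmoothFamily (n := n) y)
    (hy' : SmoothFamily (n := n) y') (t : ℝ) (x : M) :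
    varyAt (y - y') D z t x = varyAt y D z t x - varyAt y' D z t x := by
  have hh : SmoothHistories n fun q : ℝ × ℝ => z + q.1 • y + q.2 • y' :=
    ((SmoothHistories.const hz).add (SmoothHistories.smul contDiff_fst (.const hy))).add
      (SmoothHistories.smul contDiff_snd (.const hy'))
  have h := deriv_comp_prodMk (((hD.smoothHistories hh).time t).contDiff x)
    (hasDerivAt_id (0 : ℝ)) (hasDerivAt_neg (0 : ℝ))
  simp only [id_eq, neg_zero, zero_smul, add_zero, one_smul, neg_smul] at h
  rw [← sub_eq_add_neg] at h
  simp only [varyAt, ExtSym.vary, smul_sub]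
  simpa only [← add_sub_assoc, ← sub_eq_add_neg] using h

end HistoryOps

/-! ### Multiplying a variation by the elapsed time. -/

section Leibniz

variable {n : ℕ} [NeZero n] {m : ℕ} {M : Type*} [TopologicalSpace M]
  [ChartedSpace (EuclideanHalfSpace n) M] [IsManifold (𝓡∂ n) ∞ M]

theorem hasDerivAt_line {W : Type*} [NormedAddCommGroup W] [NormedSpace ℝ W] (a b : W) (s : ℝ) :
    HasDerivAt (fun ε : ℝ => a + ε • b) b s := by
  simpa using ((hasDerivAt_id s).smul_const b).const_add a

omit [IsManifold (𝓡∂ n) ∞ M] in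
theorem SmoothOp.hasDerivAt_line {W : Type*} [NormedAddCommGroup W] [NormedSpace ℝ W]
    {D : History m M → ℝ → M → W} (hD : SmoothOp n D) {z y : History m M}
    (hz : SmoothFamily (n := n) z) (hy : SmoothFamily (n := n) y) (t : ℝ) (x : M) :
    HasDerivAt (fun ε : ℝ => D (z + ε • y) t x) (deriv (fun ε : ℝ => D (z + ε • y) t x) 0) 0 :=
  ((hD.smoothHistories (SmoothHistories.line hz hy)).time t).hasDerivAt x 0

/-- The variation of `(d_t - δ_X) D`. -/
theorem SmoothOp.varyAt_totalDt_sub_vary {D : HistoryOp m M} (hD : SmoothOp n D)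
    {X : History m M → History m M} (hX : SmoothOp n X) {z y : History m M}
    (hz : SmoothFamily (n := n) z) (hy : SmoothFamily (n := n) y) (t : ℝ) (x : M) :
    varyAt y (ExtSym.totalDt D - ExtSym.vary X D) z t x =
      deriv (fun r => varyAt y D z r x) t -
        deriv (fun ε : ℝ => varyAt (y + ε • fun t x => deriv (fun η : ℝ => X (z + η • y) t x) 0) D
          (z + ε • X z) t x) 0 := by
  have hl := SmoothHistories.line hz hy
  have h0 : varyAt y (ExtSym.totalDt D - ExtSym.vary X D) z t x =
      varyAt y (ExtSym.totalDt D) z t x - varyAt y (ExtSym.vary X D) z t x :=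
    ((hD.totalDt.hasDerivAt_line hz hy t x).sub ((hD.vary hX).hasDerivAt_line hz hy t x)).deriv
  rw [h0]
  congr 1
  · exact deriv_deriv_comm (SmoothFamily.contDiff (hD.smoothHistories hl) x) 0 t
  -- After exchanging derivatives, the curve `η ↦ z + η y + ε X (z + η y)` has tangent `y + ε δ_y X`
  -- at `z + ε X z`, so it may be replaced by a straight line.
  · refine (deriv_deriv_comm (((hD.smooth_vary_curve hX hl).time t).contDiff x) 0 0).trans ?_
    congr 1
    funext ε
    have hdX : SmoothFamily (n := n) fun t x => deriv (fun η : ℝ => X (z + η • y) t x) 0 :=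
      SmoothFamily.deriv_param (hX.smoothHistories hl) 0
    refine hD.deriv_congr
      (hl.add (SmoothHistories.smul contDiff_const (hX.smoothHistories hl)))
      (SmoothHistories.line ((SmoothHistories.line hz (hX.apply hz)).history ε)
        ((SmoothHistories.line hy hdX).history ε)) (by simp) (fun t x => ?_) t x
    refine Eq.trans ?_ (ExtSym.hasDerivAt_line _ _ _).deriv.symm
    exact ((ExtSym.hasDerivAt_line (z t x) (y t x) 0).add
      ((hX.hasDerivAt_line hz hy t x).const_smul ε)).deriv

theorem SmoothOp.differentiable_varyAt {D : HistoryOp m M} (hD : SmoothOp n D)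
    {z y : History m M} (hz : SmoothFamily (n := n) z) (hy : SmoothFamily (n := n) y) (x : M) :
    Differentiable ℝ fun r => varyAt y D z r x :=
  ((SmoothFamily.deriv_param (hD.smoothHistories (SmoothHistories.line hz hy)) 0).contDiff
    x).differentiable (by simp)

theorem SmoothOp.differentiable_varyAt_line {D : HistoryOp m M} (hD : SmoothOp n D)
    {z y z' y' : History m M} (hz : SmoothFamily (n := n) z) (hy : SmoothFamily (n := n) y)
    (hz' : SmoothFamily (n := n) z') (hy' : SmoothFamily (n := n) y') (t : ℝ) (x : M) :
    Differentiable ℝ fun ε : ℝ => varyAt (y + ε • y') D (z + ε • z') t x := by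
  have h : SmoothHistories n fun q : ℝ × ℝ => (z + q.1 • z') + q.2 • (y + q.1 • y') :=
    ((SmoothHistories.line hz hz').comp contDiff_fst).add
      (SmoothHistories.smul contDiff_snd ((SmoothHistories.line hy hy').comp contDiff_fst))
  exact (((SmoothHistories.deriv_param (f := fun ε η : ℝ => D ((z + ε • z') + η • (y + ε • y')))
    (hD.smoothHistories h) 0).time t).contDiff x).differentiable (by simp)

/-- Multiplication of a history by the time elapsed since `t₀`. -/
def elapsed (t₀ : ℝ) (y : History m M) : History m M := fun t => (t - t₀) • y t

omit [IsManifold (𝓡∂ n) ∞ M] in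
theorem SmoothFamily.elapsed {y : History m M} (hy : SmoothFamily (n := n) y) (t₀ : ℝ) :
    SmoothFamily (n := n) (elapsed t₀ y) :=
  SmoothFamily.param_smul (contDiff_id.sub contDiff_const) hy

-- At a fixed time the factor `t - t₀` is a scalar, so local transformations, which contain no time
-- derivatives, commute with it. No differentiability is needed to rescale the argument of `deriv`.
omit [IsManifold (𝓡∂ n) ∞ M] in
theorem LocalOp.deriv_smul {W : Type*} [NormedAddCommGroup W] [NormedSpace ℝ W]
    (Q : LocalOp n m M W) (t a : ℝ) (z y : M → (Fin m → ℝ)) (x : M) :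
    deriv (fun η : ℝ => Q.toFun t (z + η • (a • y)) x) 0 =
      a • deriv (fun η : ℝ => Q.toFun t (z + η • y) x) 0 := by
  have := deriv_comp_mul_left a (fun η : ℝ => Q.toFun t (z + η • y) x) 0
  rw [mul_zero] at this
  simpa only [smul_smul, mul_comm] using this

/-- The Leibniz rule for the multiplication of a variation by the elapsed time is inherited by
`(d_t - δ_X) D`. -/
theorem varyAt_elapsed_step {D D' : HistoryOp m M} (hD : SmoothOp n D) (hD' : SmoothOp n D')
    {X : History m M → History m M} (hX : SmoothOp n X) (t₀ c : ℝ)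
    (hXt : ∀ (z y : History m M) (t : ℝ) (x : M),
      deriv (fun η : ℝ => X (z + η • elapsed t₀ y) t x) 0 =
        (t - t₀) • deriv (fun η : ℝ => X (z + η • y) t x) 0)
    (h : ∀ z y : History m M, SmoothFamily (n := n) z → SmoothFamily (n := n) y → ∀ t x,
      varyAt (elapsed t₀ y) D z t x = (t - t₀) * varyAt y D z t x + c * varyAt y D' z t x)
    {z y : History m M} (hz : SmoothFamily (n := n) z) (hy : SmoothFamily (n := n) y)
    (t : ℝ) (x : M) :
    varyAt (elapsed t₀ y) (totalDt D - vary X D) z t x =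
      (t - t₀) * varyAt y (totalDt D - vary X D) z t x +
        (c * varyAt y (totalDt D' - vary X D') z t x + varyAt y D z t x) := by
  have hdX : SmoothFamily (n := n) fun t x => deriv (fun η : ℝ => X (z + η • y) t x) 0 :=
    SmoothFamily.deriv_param (hX.smoothHistories (SmoothHistories.line hz hy)) 0
  rw [hD.varyAt_totalDt_sub_vary hX hz (hy.elapsed t₀), hD.varyAt_totalDt_sub_vary hX hz hy,
    hD'.varyAt_totalDt_sub_vary hX hz hy]
  -- The additional term `varyAt y D z t x` arises here alone, from `d_t` acting on `t - t₀`.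
  have e1 : deriv (fun r => varyAt (elapsed t₀ y) D z r x) t =
      varyAt y D z t x + (t - t₀) * deriv (fun r => varyAt y D z r x) t +
        c * deriv (fun r => varyAt y D' z r x) t := by
    simp only [h z y hz hy]
    have d1 := (hD.differentiable_varyAt hz hy x t).hasDerivAt
    have d2 := (hD'.differentiable_varyAt hz hy x t).hasDerivAt
    have d3 := ((((hasDerivAt_id t).sub_const t₀).mul d1).add (d2.const_mul c)).deriv
    rw [one_mul] at d3
    exact d3
  have e2 : ∀ ε : ℝ, elapsed t₀ y +
      ε • (fun t x => deriv (fun η : ℝ => X (z + η • elapsed t₀ y) t x) 0) =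
        elapsed t₀ (y + ε • fun t x => deriv (fun η : ℝ => X (z + η • y) t x) 0) := fun ε => by
    funext t x
    simp only [elapsed, Pi.add_apply, Pi.smul_apply, smul_add]
    rw [smul_comm (t - t₀) ε]
    exact congrArg (fun w => (t - t₀) • y t x + ε • w) (hXt z y t x)
  have hzX := SmoothHistories.line hz (hX.apply hz)
  have hyX := SmoothHistories.line hy hdX
  simp only [e2, fun ε => h _ _ (hzX.history ε) (hyX.history ε) t x]
  have d1 := (hD.differentiable_varyAt_line hz hy (hX.apply hz) hdX t x 0).hasDerivAt
  have d2 := (hD'.differentiable_varyAt_line hz hy (hX.apply hz) hdX t x 0).hasDerivAt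
  have d3 := ((d1.const_mul (t - t₀)).add (d2.const_mul c)).deriv
  rw [e1]
  refine (congrArg (_ - ·) d3).trans ?_
  ring

end Leibniz

/-! ### Variations of the external boundary conditions. -/

namespace FieldTheory

variable {n : ℕ} [NeZero n] {m : ℕ} {M : Type*} [TopologicalSpace M]
  [ChartedSpace (EuclideanHalfSpace n) M] [IsManifold (𝓡∂ n) ∞ M] [MeasurableSpace M]
  {μ : Measure M} {ι : Type*} (T : FieldTheory n m μ ι)

theorem smoothOp_deltaH : SmoothOp n T.deltaH :=
  (T.H.grad.matrix T.σ).smoothOp fun s t z hz x =>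
    congrArg (T.σ *ᵥ ·) (T.H_autonomous.2 s t z hz x)

theorem smoothOp_chiE (α : ι) (k : ℕ) : SmoothOp n (T.chiE α k) := by
  induction k with
  | zero => exact (T.χ α).smoothOp (T.χ_autonomous α)
  | succ k ih => exact ih.totalDt.sub (ih.vary T.smoothOp_deltaH)

/-- This is the commutator `[(d_t - δ_H)^k, t - t₀] = k (d_t - δ_H)^{k-1}`. The truncated index at
`k = 0` is harmless because its coefficient is zero. -/
theorem varyAt_elapsed_chiE (α : ι) (t₀ : ℝ) (k : ℕ) :
    ∀ z y : History m M, SmoothFamily (n := n) z → SmoothFamily (n := n) y → ∀ t x,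
      varyAt (elapsed t₀ y) (T.chiE α k) z t x =
        (t - t₀) * varyAt y (T.chiE α k) z t x + k * varyAt y (T.chiE α (k - 1)) z t x := by
  induction k with
  | zero =>
    intro z y hz hy t x
    rw [Nat.cast_zero, zero_mul, add_zero]
    exact (T.χ α).deriv_smul t (t - t₀) (z t) (y t) x
  | succ k ih =>
    intro z y hz hy t x
    have h := varyAt_elapsed_step (T.smoothOp_chiE α k) (T.smoothOp_chiE α (k - 1))
      T.smoothOp_deltaH t₀ k
      (fun z y t x => (T.H.grad.matrix T.σ).deriv_smul t (t - t₀) (z t) (y t) x) ih hz hy t x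
    refine h.trans ?_
    cases k with
    | zero => simp [chiE]
    | succ k => simp only [chiE, Nat.add_sub_cancel]; push_cast; ring

variable {T}

omit [IsManifold (𝓡∂ n) ∞ M] in
theorem PreservesInternal.varyAt_chiE {z y : History m M} (h : T.PreservesInternal z y) (α : ι)
    (k : ℕ) (t : ℝ) {x : M} (hx : x ∈ (𝓡∂ n).boundary M) :
    varyAt y (T.chiE α k) z t x = 0 := by
  cases k with
  | zero => exact h.2 α t x hx
  | succ k => exact h.1.2 α (k + 1) k.succ_pos t x hx

/-- Variations that preserve the internal boundary conditions may be multiplied by the elapsed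
time. -/
theorem PreservesInternal.elapsed {z y : History m M} (hz : SmoothFamily (n := n) z)
    (h : T.PreservesInternal z y) (t₀ : ℝ) : T.PreservesInternal z (elapsed t₀ y) := by
  have key : ∀ (α : ι) (k : ℕ) (t : ℝ), ∀ x ∈ (𝓡∂ n).boundary M,
      varyAt (ExtSym.elapsed t₀ y) (T.chiE α k) z t x = 0 := fun α k t x hx => by
    rw [T.varyAt_elapsed_chiE α t₀ k z y hz h.1.1 t x, h.varyAt_chiE α k t hx,
      h.varyAt_chiE α (k - 1) t hx]
    ring
  exact ⟨⟨h.1.1.elapsed t₀, fun α k _ => key α k⟩, fun α => key α 0⟩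

/-- On histories satisfying the external boundary conditions, the difference of the velocity and
the hamiltonian flow preserves the internal boundary conditions. -/
theorem Admissible.preservesInternal_velocity_sub {z : History m M} (hz : T.Admissible z) :
    T.PreservesInternal z (velocity z - T.deltaH z) := by
  have hX := T.smoothOp_deltaH.apply hz.1
  have key : ∀ (α : ι) (k : ℕ) (t : ℝ), ∀ x ∈ (𝓡∂ n).boundary M,
      varyAt (velocity z - T.deltaH z) (T.chiE α k) z t x = 0 := fun α k t x hx => by
    rw [(T.smoothOp_chiE α k).varyAt_sub hz.1 hz.1.velocity hX,
      ← (T.smoothOp_chiE α k).totalDt_eq_varyAt hz.1]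
    exact hz.2 α (k + 1) k.succ_pos t x hx
  exact ⟨⟨hz.1.velocity.sub hX, fun α k _ => key α k⟩, fun α => key α 0⟩

/-- The external boundary conditions only involve a neighborhood of the boundary. -/
theorem Admissible.congr {z z' : History m M} (hz : T.Admissible z)
    (hz' : SmoothFamily (n := n) z') {U : Set M} (hU : IsOpen U) (hb : (𝓡∂ n).boundary M ⊆ U)
    (h : ∀ t, ∀ x ∈ U, z' t x = z t x) : T.Admissible z' :=
  ⟨hz', fun α k hk t x hx => by
    rw [(T.smoothOp_chiE α k).eq_of_eqOn z' z hz' hz.1 U hU h t x (hb hx)]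
    exact hz.2 α k hk t x hx⟩

/-- Variations vanishing near the boundary preserve the internal boundary conditions. -/
theorem preservesInternal_of_eqOn_zero {z y : History m M} (hz : SmoothFamily (n := n) z)
    (hy : SmoothFamily (n := n) y) {U : Set M} (hU : IsOpen U) (hb : (𝓡∂ n).boundary M ⊆ U)
    (h : ∀ t, ∀ x ∈ U, y t x = 0) : T.PreservesInternal z y := by
  have key : ∀ (α : ι) (k : ℕ) (t : ℝ), ∀ x ∈ (𝓡∂ n).boundary M,
      varyAt y (T.chiE α k) z t x = 0 := fun α k t x hx => by
    have e : ∀ ε : ℝ, T.chiE α k (z + ε • y) t x = T.chiE α k z t x := fun ε =>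
      (T.smoothOp_chiE α k).eq_of_eqOn _ z ((SmoothHistories.line hz hy).history ε) hz U hU
        (fun t x hx => by simp [h t x hx]) t x (hb hx)
    simp only [varyAt, vary, e, deriv_const]
  exact ⟨⟨hy, fun α k _ => key α k⟩, fun α => key α 0⟩

end FieldTheory

/-! ### Integrals over arbitrary time intervals. -/

section IntervalIntegral

theorem hasDerivAt_intervalIntegral {F : ℝ × ℝ → ℝ} (hF : ContDiff ℝ ∞ F) (a b s : ℝ) :
    HasDerivAt (fun s => ∫ t in a..b, F (s, t)) (∫ t in a..b, deriv (fun s => F (s, t)) s) s := by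
  have hd : ∀ r t, HasDerivAt (fun s => F (s, t)) (fderiv ℝ F (r, t) (1, 0)) r := fun r t =>
    (hF.differentiable (by simp) (r, t)).hasFDerivAt.comp_hasDerivAt r
      ((hasDerivAt_id _).prodMk (hasDerivAt_const _ _))
  have hc : Continuous fun q : ℝ × ℝ => fderiv ℝ F q (1, 0) :=
    (hF.continuous_fderiv (by simp)).clm_apply continuous_const
  obtain ⟨C, hC⟩ := ((isCompact_closedBall s 1).prod (isCompact_uIcc (a := a) (b := b))
    ).exists_bound_of_continuousOn hc.continuousOn
  have e : ∀ t, deriv (fun s => F (s, t)) s = fderiv ℝ F (s, t) (1, 0) := fun t => (hd s t).deriv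
  simp only [e]
  refine (intervalIntegral.hasDerivAt_integral_of_dominated_loc_of_deriv_le
    (F' := fun r t => fderiv ℝ F (r, t) (1, 0))
    (bound := fun _ => C) (Metric.closedBall_mem_nhds s one_pos)
    (Filter.Eventually.of_forall fun r =>
      (hF.continuous.comp (by fun_prop : Continuous fun t : ℝ => (r, t))).aestronglyMeasurable)
    ((hF.continuous.comp (by fun_prop : Continuous fun t : ℝ => (s, t))).intervalIntegrable _ _)
    (hc.comp (by fun_prop : Continuous fun t : ℝ => (s, t))).aestronglyMeasurable
    (Filter.Eventually.of_forall fun t ht r hr => hC (r, t) ⟨hr, Set.uIoc_subset_uIcc ht⟩)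
    intervalIntegrable_const
    (Filter.Eventually.of_forall fun t _ r _ => hd r t)).2

theorem eq_of_forall_intervalIntegral_eq {f g : ℝ → ℝ} (hf : Continuous f) (hg : Continuous g)
    (h : ∀ a b : ℝ, ∫ t in a..b, f t = ∫ t in a..b, g t) (t : ℝ) : f t = g t := by
  have h1 := hf.deriv_integral f 0 t
  have h2 := hg.deriv_integral g 0 t
  simp only [h] at h1
  exact h1.symm.trans h2

end IntervalIntegral

/-! ### Variations and total time derivatives of local functionals. -/

section Functionals

variable {n : ℕ} [NeZero n] {m : ℕ} {M : Type*} [TopologicalSpace M]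
  [ChartedSpace (EuclideanHalfSpace n) M] 

theorem SmoothFamily.line {z y : M → (Fin m → ℝ)} (hz : SmoothConfig (n := n) z)
    (hy : SmoothConfig (n := n) y) : SmoothFamily (n := n) fun ε : ℝ => z + ε • y :=
  hz.family.add (SmoothFamily.param_smul contDiff_id hy.family)

section

variable {W : Type*} [NormedAddCommGroup W] [NormedSpace ℝ W]

theorem LocalOp.smoothFamily_frozen (Q : LocalOp n m M W) (t : ℝ) {P : Type*}
    [NormedAddCommGroup P] [NormedSpace ℝ P] [FiniteDimensional ℝ P] {f : P → M → (Fin m → ℝ)}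
    (hf : SmoothFamily (n := n) f) : SmoothFamily (n := n) fun q => Q.toFun t (f q) :=
  (Q.smoothFamily hf).comp (contDiff_const.prodMk contDiff_id)

theorem LocalOp.smoothFamily_history (Q : LocalOp n m M W) {P : Type*}
    [NormedAddCommGroup P] [NormedSpace ℝ P] [FiniteDimensional ℝ P] {f : P → History m M}
    (hf : SmoothHistories n f) : SmoothHistories n fun q t => Q.toFun t (f q t) :=
  (Q.smoothFamily hf).comp (φ := fun q : P × ℝ => (q.2, q)) (contDiff_snd.prodMk contDiff_id)

theorem LocalOp.smooth_history (Q : LocalOp n m M W) {z : History m M}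
    (hz : SmoothFamily (n := n) z) : SmoothFamily (n := n) fun t => Q.toFun t (z t) :=
  (Q.smoothFamily_history (SmoothHistories.const (P := ℝ) hz)).history 0

variable [IsManifold (𝓡∂ n) ∞ M]

/-- The chain rule for local functions along curves of configurations. -/
theorem LocalOp.deriv_congr (Q : LocalOp n m M W) (t : ℝ) {c c' : ℝ → M → (Fin m → ℝ)}
    (hc : SmoothFamily (n := n) c) (hc' : SmoothFamily (n := n) c') (h0 : c 0 = c' 0)
    (h1 : ∀ x, deriv (fun s => c s x) 0 = deriv (fun s => c' s x) 0) (x : M) :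
    deriv (fun s => Q.toFun t (c s) x) 0 = deriv (fun s => Q.toFun t (c' s) x) 0 := by
  have hQ : SmoothOp n fun (z : History m M) s => (Q.freeze t).toFun s (z s) :=
    (Q.freeze t).smoothOp fun _ _ _ _ _ => rfl
  exact hQ.deriv_congr (f := fun s _ => c s) (g := fun s _ => c' s)
    (hc.comp contDiff_fst) (hc'.comp contDiff_fst) (funext fun _ => h0) (fun _ x => h1 x) 0 x

end

variable [IsManifold (𝓡∂ n) ∞ M] [CompactSpace M] [MeasurableSpace M] [BorelSpace M] (κ : Measure M) [IsFiniteMeasure κ]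
  (g : LocalOp n m M ℝ)

/-- The integral of a local function. -/
noncomputable def LocalOp.integral (t : ℝ) (z : M → (Fin m → ℝ)) : ℝ := ∫ x, g.toFun t z x ∂κ

theorem LocalOp.variation_integral (t : ℝ) {z y : M → (Fin m → ℝ)} (hz : SmoothConfig (n := n) z)
    (hy : SmoothConfig (n := n) y) :
    variation (g.integral κ t) z y = ∫ x, deriv (fun ε : ℝ => g.toFun t (z + ε • y) x) 0 ∂κ :=
  ((g.smoothFamily_frozen t (SmoothFamily.line hz hy)).hasDerivAt_integral κ 0).deriv

/-- The chain rule for local functionals along curves of configurations. -/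
theorem LocalOp.deriv_integral_curve (t : ℝ) {c : ℝ → M → (Fin m → ℝ)}
    (hc : SmoothFamily (n := n) c) {y : M → (Fin m → ℝ)} (hy : SmoothConfig (n := n) y)
    (h : ∀ x, deriv (fun s => c s x) 0 = y x) :
    deriv (fun s => g.integral κ t (c s)) 0 = variation (g.integral κ t) (c 0) y := by
  rw [g.variation_integral κ t (hc.config 0) hy]
  refine ((g.smoothFamily_frozen t hc).hasDerivAt_integral κ 0).deriv.trans ?_
  congr 1
  funext x
  refine g.deriv_congr t hc (SmoothFamily.line (hc.config 0) hy) (by simp) (fun x => ?_) x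
  exact (h x).trans (hasDerivAt_line _ _ _).deriv.symm

omit [IsManifold (𝓡∂ n) ∞ M] [CompactSpace M] [BorelSpace M] [IsFiniteMeasure κ] in
theorem LocalOp.variation_zero (t : ℝ) (z : M → (Fin m → ℝ)) :
    variation (g.integral κ t) z 0 = 0 := by
  simp [variation]

omit [IsManifold (𝓡∂ n) ∞ M] [CompactSpace M] [BorelSpace M] [IsFiniteMeasure κ] in
theorem LocalOp.variation_smul (t a : ℝ) (z y : M → (Fin m → ℝ)) :
    variation (g.integral κ t) z (a • y) = a * variation (g.integral κ t) z y := by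
  have := deriv_comp_mul_left a (fun η : ℝ => g.integral κ t (z + η • y)) 0
  rw [mul_zero] at this
  simpa only [variation, smul_smul, mul_comm, smul_eq_mul] using this

theorem LocalOp.variation_sub (t : ℝ) {z y y' : M → (Fin m → ℝ)} (hz : SmoothConfig (n := n) z)
    (hy : SmoothConfig (n := n) y) (hy' : SmoothConfig (n := n) y') :
    variation (g.integral κ t) z (y - y') =
      variation (g.integral κ t) z y - variation (g.integral κ t) z y' := by
  have hh : SmoothFamily (n := n) fun q : ℝ × ℝ => z + q.1 • y + q.2 • y' :=
    ((SmoothConfig.family hz).add (SmoothFamily.param_smul contDiff_fst hy.family)).add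
      (SmoothFamily.param_smul contDiff_snd hy'.family)
  have h := deriv_comp_prodMk ((g.smoothFamily_frozen t hh).contDiff_integral κ)
    (hasDerivAt_id (0 : ℝ)) (hasDerivAt_neg (0 : ℝ))
  simp only [id_eq, neg_zero, zero_smul, add_zero, one_smul, neg_smul] at h
  rw [← sub_eq_add_neg] at h
  simp only [variation, smul_sub]
  simpa only [← add_sub_assoc, ← sub_eq_add_neg, LocalOp.integral] using h

theorem LocalOp.contDiff_integral {P : Type} [NormedAddCommGroup P] [NormedSpace ℝ P]
    [FiniteDimensional ℝ P] {f : P → History m M} (hf : SmoothHistories n f) :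
    ContDiff ℝ ∞ fun q : P × ℝ => g.integral κ q.2 (f q.1 q.2) :=
  (SmoothFamily.contDiff_integral (g.smoothFamily_history hf) κ)

theorem LocalOp.contDiff_integral_history {z : History m M} (hz : SmoothFamily (n := n) z) :
    ContDiff ℝ ∞ fun t => g.integral κ t (z t) :=
  SmoothFamily.contDiff_integral (g.smooth_history hz) κ

theorem LocalOp.contDiff_variation {z y : History m M} (hz : SmoothFamily (n := n) z)
    (hy : SmoothFamily (n := n) y) :
    ContDiff ℝ ∞ fun t => variation (g.integral κ t) (z t) (y t) := by
  have h : SmoothFamily (n := n) fun t x =>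
      deriv (fun ε : ℝ => g.toFun t (z t + ε • y t) x) 0 :=
    SmoothFamily.deriv_param (g.smoothFamily_history (SmoothHistories.line hz hy)) 0
  have h2 := h.contDiff_integral κ
  simpa only [g.variation_integral κ _ (hz.config _) (hy.config _)] using h2

/-- The total time derivative of a local functional along a history. -/
theorem LocalOp.deriv_integral_history {z : History m M} (hz : SmoothFamily (n := n) z) (t : ℝ) :
    deriv (fun s => g.integral κ s (z s)) t =
      deriv (fun s => g.integral κ s (z t)) t +
        variation (g.integral κ t) (z t) (velocity z t) := by
  -- Explicit time and the time entering through `z` are treated as independent variables, then set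
  -- equal.
  have h := deriv_comp_prodMk ((g.smoothFamily hz).contDiff_integral κ)
    (hasDerivAt_id t) (hasDerivAt_id t)
  simp only [id_eq, one_smul] at h
  refine h.trans (congrArg (deriv (fun s => g.integral κ s (z t)) t + ·) ?_)
  have e := g.deriv_integral_curve κ t (c := fun s => z (t + s))
    (hz.comp (contDiff_const.add contDiff_id)) (hz.velocity.config t) (fun x => by
      rw [deriv_comp_const_add (fun r => z r x) t 0, add_zero]
      rfl)
  rw [deriv_comp_const_add (fun r => g.integral κ t (z r)) t 0, add_zero] at e
  exact e

end Functionals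

/-! ### Densities for the Noether charge. -/

section LocalOpAlgebra

variable {n : ℕ} [NeZero n] {m : ℕ} {M : Type*} [TopologicalSpace M]
  [ChartedSpace (EuclideanHalfSpace n) M]

theorem SameJet.mono {W : Type*} [NormedAddCommGroup W] [NormedSpace ℝ W] {k l : ℕ} (h : k ≤ l)
    {f g : M → W} {x : M} (hfg : SameJet (n := n) l f g x) : SameJet (n := n) k f g x :=
  fun j hj => hfg j (hj.trans h)

theorem SameJet.eq {W : Type*} [NormedAddCommGroup W] [NormedSpace ℝ W] {k : ℕ}
    {f g : M → W} {x : M} (h : SameJet (n := n) k f g x) : f x = g x := by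
  have h0 := congrArg (fun A => A 0) (h 0 k.zero_le)
  simpa only [iteratedFDerivWithin_zero_apply, Function.comp_apply, extChartAt_to_inv] using h0

/-- The local function `½ z^A B_{AB} Z^B`. -/
noncomputable def LocalOp.halfPairing (B : Matrix (Fin m) (Fin m) ℝ)
    (Z : LocalOp n m M (Fin m → ℝ)) :
    LocalOp n m M ℝ where
  toFun t z x := (1 / 2 : ℝ) * (z x ⬝ᵥ (B *ᵥ Z.toFun t z x))
  order := Z.order
  jet t f g x hf hg h := by rw [Z.jet t f g x hf hg h, h.eq]
  smooth p f hf := ((hf.comp (φ := fun q : ℝ × EuclideanSpace ℝ (Fin p) => q.2)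
    contDiff_snd).dotProduct ((Z.smooth p f hf).mulVec B)).map (g := fun r : ℝ => (1 / 2 : ℝ) * r)
      (contDiff_const.mul contDiff_id)

/-- The difference of two local functions. -/
def LocalOp.sub (P Q : LocalOp n m M ℝ) : LocalOp n m M ℝ where
  toFun t z x := P.toFun t z x - Q.toFun t z x
  order := max P.order Q.order
  jet t f g x hf hg h := by
    rw [P.jet t f g x hf hg (h.mono (le_max_left _ _)),
      Q.jet t f g x hf hg (h.mono (le_max_right _ _))]
  smooth p f hf := (P.smooth p f hf).sub (Q.smooth p f hf)

end LocalOpAlgebra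

/-! ### Antisymmetric pairings. -/

section Antisymm

theorem _root_.HasDerivAt.dotProduct {m : ℕ} {f g : ℝ → Fin m → ℝ} {f' g' : Fin m → ℝ} {s : ℝ}
    (hf : HasDerivAt f f' s) (hg : HasDerivAt g g' s) :
    HasDerivAt (fun s => f s ⬝ᵥ g s) (f' ⬝ᵥ g s + f s ⬝ᵥ g') s := by
  unfold _root_.dotProduct
  rw [← Finset.sum_add_distrib]
  exact HasDerivAt.fun_sum fun i _ => (hasDerivAt_pi.1 hf i).mul (hasDerivAt_pi.1 hg i)

theorem _root_.HasDerivAt.mulVec {m : ℕ} (A : Matrix (Fin m) (Fin m) ℝ) {f : ℝ → Fin m → ℝ}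
    {f' : Fin m → ℝ} {s : ℝ} (hf : HasDerivAt f f' s) :
    HasDerivAt (fun s => A *ᵥ f s) (A *ᵥ f') s :=
  (LinearMap.toContinuousLinearMap A.mulVecLin).hasFDerivAt.comp_hasDerivAt s hf

variable {m : ℕ} {A : Matrix (Fin m) (Fin m) ℝ}

theorem dotProduct_mulVec_antisymm (hA : Aᵀ = -A) (v w : Fin m → ℝ) :
    v ⬝ᵥ (A *ᵥ w) = -((A *ᵥ v) ⬝ᵥ w) := by
  rw [dotProduct_mulVec, ← mulVec_transpose, hA, neg_mulVec, neg_dotProduct]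

theorem transpose_inv_antisymm (hA : Aᵀ = -A) : (A⁻¹)ᵀ = -A⁻¹ := by
  rw [transpose_nonsing_inv, hA]
  by_cases h : IsUnit A.det
  · exact inv_eq_left_inv (by simp [nonsing_inv_mul A h])
  · have h' : ¬ IsUnit (-A).det := by rwa [← hA, det_transpose]
    rw [nonsing_inv_apply_not_isUnit _ h, nonsing_inv_apply_not_isUnit _ h', neg_zero]

end Antisymm

/-! ### The variation of the action and the balance equation. -/

namespace FieldTheory

variable {n : ℕ} [NeZero n] {m : ℕ} {M : Type*} [TopologicalSpace M]
  [ChartedSpace (EuclideanHalfSpace n) M] [IsManifold (𝓡∂ n) ∞ M] [CompactSpace M]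
  [MeasurableSpace M] [BorelSpace M]
  {μ : Measure M} [IsFiniteMeasure μ] {ι : Type*} (T : FieldTheory n m μ ι)
  (ν : Measure M) [IsFiniteMeasure ν]

/-- The gradient `σ_{AB} Z^B` of a functional that generates `Z`. -/
noncomputable def lowered (Z : LocalOp n m M (Fin m → ℝ)) : LocalOp n m M (Fin m → ℝ) := Z.matrix T.σ⁻¹

/-- The local conservation law
`d/dt ∫ g dⁿx = ∫ (σ_{AB} Z^B) ż^A dⁿx + δ_Z H + ∮ V` of a transformation `Z` at time `t`. -/
def Balance (Z : LocalOp n m M (Fin m → ℝ)) (V g : LocalOp n m M ℝ) (z : History m M) (t : ℝ) :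
    Prop :=
  deriv (fun s => g.integral μ s (z s)) t =
    (∫ x, (T.lowered Z).toFun t (z t) x ⬝ᵥ velocity z t x ∂μ) +
      variation (T.H.density.integral μ t) (z t) (Z.toFun t (z t)) +
      boundaryIntegral ν V t (z t)

section Action

variable {T}
variable {z : History m M} (hz : SmoothFamily (n := n) z) (Z : LocalOp n m M (Fin m → ℝ))
include hz

omit [IsManifold (𝓡∂ n) ∞ M] [CompactSpace M] [MeasurableSpace M] [BorelSpace M] in
theorem velocity_line {y : History m M} (hy : SmoothFamily (n := n) y) (ε : ℝ) :
    velocity (z + ε • y) = velocity z + ε • velocity y := by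
  funext t x
  exact ((hz.hasDerivAt x t).add ((hy.hasDerivAt x t).const_smul ε)).deriv

-- Moving the time derivative off `Z` leaves two half terms in `ż`; antisymmetry of `σ_{AB}` makes
-- them equal.
omit [IsManifold (𝓡∂ n) ∞ M] [CompactSpace M] [BorelSpace M] [IsFiniteMeasure μ] in
theorem deriv_kinetic (t : ℝ) (x : M) :
    deriv (fun ε : ℝ => (1 / 2 : ℝ) * ((z + ε • transf Z z) t x ⬝ᵥ
        (T.σ⁻¹ *ᵥ velocity (z + ε • transf Z z) t x))) 0 =
      deriv (fun s => (Z.halfPairing T.σ⁻¹).toFun s (z s) x) t -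
        (T.lowered Z).toFun t (z t) x ⬝ᵥ velocity z t x := by
  have hY : SmoothFamily (n := n) (transf Z z) := Z.smooth_history hz
  simp only [velocity_line hz hY]
  have h1 := ((ExtSym.hasDerivAt_line (z t x) (transf Z z t x) 0).dotProduct
    ((ExtSym.hasDerivAt_line (velocity z t x) (velocity (transf Z z) t x) 0).mulVec
      T.σ⁻¹)).const_mul (1 / 2 : ℝ)
  have h2 := ((hz.hasDerivAt x t).dotProduct ((hY.hasDerivAt x t).mulVec T.σ⁻¹)).const_mul
    (1 / 2 : ℝ)
  refine h1.deriv.trans ?_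
  rw [show deriv (fun s => (Z.halfPairing T.σ⁻¹).toFun s (z s) x) t = _ from h2.deriv,
    zero_smul, zero_smul, add_zero, add_zero,
    dotProduct_mulVec_antisymm (transpose_inv_antisymm T.σ_antisymm) (transf Z z t x)]
  change (1 / 2 : ℝ) * (-((T.σ⁻¹ *ᵥ transf Z z t x) ⬝ᵥ velocity z t x) +
      z t x ⬝ᵥ (T.σ⁻¹ *ᵥ velocity (transf Z z) t x)) =
    (1 / 2 : ℝ) * (velocity z t x ⬝ᵥ (T.σ⁻¹ *ᵥ transf Z z t x) +
      z t x ⬝ᵥ (T.σ⁻¹ *ᵥ velocity (transf Z z) t x)) -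
      (T.σ⁻¹ *ᵥ transf Z z t x) ⬝ᵥ velocity z t x
  rw [dotProduct_comm (velocity z t x)]
  ring

/-- The variation of the action under a local transformation. -/
theorem deriv_action (t₀ t₁ : ℝ) :
    deriv (fun ε : ℝ => T.action t₀ t₁ (z + ε • transf Z z)) 0 =
      ∫ t in t₀..t₁, (deriv (fun s => (Z.halfPairing T.σ⁻¹).integral μ s (z s)) t -
        (∫ x, (T.lowered Z).toFun t (z t) x ⬝ᵥ velocity z t x ∂μ) -
        variation (T.H.density.integral μ t) (z t) (Z.toFun t (z t))) := by
  have hY : SmoothFamily (n := n) (transf Z z) := Z.smooth_history hz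
  have hl := SmoothHistories.line hz hY
  have hv : SmoothHistories n fun ε : ℝ => velocity (z + ε • transf Z z) :=
    SmoothFamily.deriv_snd hl
  have hk : SmoothHistories n fun ε t x => (1 / 2 : ℝ) * ((z + ε • transf Z z) t x ⬝ᵥ
      (T.σ⁻¹ *ᵥ velocity (z + ε • transf Z z) t x)) :=
    SmoothFamily.map (SmoothFamily.dotProduct hl (SmoothFamily.mulVec T.σ⁻¹ hv))
      (g := fun r : ℝ => (1 / 2 : ℝ) * r) (contDiff_const.mul contDiff_id)
  have hA : ContDiff ℝ ∞ fun q : ℝ × ℝ =>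
      (∫ x, (1 / 2 : ℝ) * ((z + q.1 • transf Z z) q.2 x ⬝ᵥ
        (T.σ⁻¹ *ᵥ velocity (z + q.1 • transf Z z) q.2 x)) ∂μ) -
      T.H.density.integral μ q.2 ((z + q.1 • transf Z z) q.2) :=
    (SmoothFamily.contDiff_integral hk μ).sub (T.H.density.contDiff_integral μ hl)
  refine (hasDerivAt_intervalIntegral hA t₀ t₁ 0).deriv.trans ?_
  refine intervalIntegral.integral_congr fun t _ => ?_
  have h1 := (hk.time t).hasDerivAt_integral μ 0
  have h2 : HasDerivAt (fun ε : ℝ => T.H.density.integral μ t ((z + ε • transf Z z) t))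
      (variation (T.H.density.integral μ t) (z t) (Z.toFun t (z t))) 0 :=
    (((T.H.density.contDiff_integral μ hl).comp
      (contDiff_id.prodMk contDiff_const)).differentiable (by simp) (0 : ℝ)).hasDerivAt
  refine (h1.sub h2).deriv.trans ?_
  congr 1
  have h3 := (Z.halfPairing T.σ⁻¹).smooth_history hz
  rw [show deriv (fun s => (Z.halfPairing T.σ⁻¹).integral μ s (z s)) t = _ from
    (h3.hasDerivAt_integral μ t).deriv, ← integral_sub]
  · exact integral_congr_ae (Filter.Eventually.of_forall fun x => deriv_kinetic hz Z t x)
  · exact ((SmoothFamily.deriv_at (P := ℝ)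
      (f := fun _ t => (Z.halfPairing T.σ⁻¹).toFun t (z t)) (h3.comp contDiff_snd) contDiff_id
      contDiff_id).config t).integrable μ
  · exact (((((T.lowered Z).smooth_history hz).dotProduct hz.velocity).config t)).integrable μ

end Action

/-- The variation of the action under `Z` is a total derivative up to a boundary term if and only
if the balance equation holds at all times. -/
theorem forall_deriv_action_eq_iff (Z : LocalOp n m M (Fin m → ℝ)) (V U : LocalOp n m M ℝ)
    {z : History m M} (hz : SmoothFamily (n := n) z) :
    (∀ t₀ t₁ : ℝ, deriv (fun ε : ℝ => T.action t₀ t₁ (z + ε • transf Z z)) 0 =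
      ∫ t in t₀..t₁,
        (deriv (fun s => ∫ x, U.toFun s (z s) x ∂μ) t + boundaryIntegral ν V t (z t))) ↔
      ∀ t, T.Balance ν Z V ((Z.halfPairing T.σ⁻¹).sub U) z t := by
  have hk := (Z.halfPairing T.σ⁻¹).contDiff_integral_history μ hz
  have hu := U.contDiff_integral_history μ hz
  have hB : ∀ t, T.Balance ν Z V ((Z.halfPairing T.σ⁻¹).sub U) z t ↔
      deriv (fun s => (Z.halfPairing T.σ⁻¹).integral μ s (z s)) t -
        (∫ x, (T.lowered Z).toFun t (z t) x ⬝ᵥ velocity z t x ∂μ) -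
        variation (T.H.density.integral μ t) (z t) (Z.toFun t (z t)) =
      deriv (fun s => U.integral μ s (z s)) t + boundaryIntegral ν V t (z t) := by
    intro t
    have e : (fun s => ((Z.halfPairing T.σ⁻¹).sub U).integral μ s (z s)) = fun s =>
        (Z.halfPairing T.σ⁻¹).integral μ s (z s) - U.integral μ s (z s) := funext fun s =>
      integral_sub ((((Z.halfPairing T.σ⁻¹).smooth_history hz).config s).integrable μ)
        (((U.smooth_history hz).config s).integrable μ)
    have e2 := ((hk.differentiable (by simp) t).hasDerivAt.sub
      (hu.differentiable (by simp) t).hasDerivAt).deriv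
    rw [Balance, e]
    constructor
    · intro h
      linarith [e2.symm.trans h]
    · intro h
      refine e2.trans ?_
      linarith
  simp only [hB, deriv_action hz]
  refine ⟨fun h => eq_of_forall_intervalIntegral_eq ?_ ?_ h, fun h t₀ t₁ =>
    intervalIntegral.integral_congr fun t _ => h t⟩
  · have h1 : ContDiff ℝ ∞ fun t => ∫ x, (T.lowered Z).toFun t (z t) x ⬝ᵥ velocity z t x ∂μ :=
      (((T.lowered Z).smooth_history hz).dotProduct hz.velocity).contDiff_integral μ
    have h2 := T.H.density.contDiff_variation μ hz (Z.smooth_history hz)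
    exact ((hk.continuous_deriv (by simp)).sub h1.continuous).sub h2.continuous
  · exact (hu.continuous_deriv (by simp)).add
      (V.contDiff_integral_history (ν.restrict ((𝓡∂ n).boundary M)) hz).continuous

variable {T ν} in
/-- A balance equation along a curve of histories tangent to `(t - t₀) y` computes the variation
along `y` at time `t₀`. -/
theorem variation_eq_of_balance {Z : LocalOp n m M (Fin m → ℝ)} {V g : LocalOp n m M ℝ} {t₀ : ℝ}
    {c : ℝ → History m M} (hc : SmoothHistories n c) {y : History m M}
    (hy : SmoothFamily (n := n) y)
    (hcy : ∀ t x, deriv (fun s => c s t x) 0 = elapsed t₀ y t x)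
    (h : ∀ s, T.Balance ν Z V g (c s) t₀) :
    variation (g.integral μ t₀) (c 0 t₀) (y t₀) =
      ∫ x, (T.lowered Z).toFun t₀ (c 0 t₀) x ⬝ᵥ y t₀ x ∂μ := by
  have hz := hc.history 0
  -- The factor `t - t₀` vanishes at `t₀`: terms depending only on the configuration at `t₀` are
  -- stationary in `s`, and only those containing a velocity can contribute.
  have h0 : ∀ x, deriv (fun s => c s t₀ x) 0 = 0 := fun x => by simp [hcy, elapsed]
  have hy0 := hy.config t₀
  -- The `s`-derivative of the left side of the balance; exchanging derivatives gives `d/dt ((t -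
  -- t₀) δ_y ∫ g)` at `t₀`.
  have e1 : deriv (fun s => deriv (fun t => g.integral μ t (c s t)) t₀) 0 =
      variation (g.integral μ t₀) (c 0 t₀) (y t₀) := by
    rw [deriv_deriv_comm (g.contDiff_integral μ hc) 0 t₀]
    have e : (fun t => deriv (fun s => g.integral μ t (c s t)) 0) = fun t =>
        (t - t₀) * variation (g.integral μ t) (c 0 t) (y t) := funext fun t => by
      rw [g.deriv_integral_curve μ t (hc.time t) ((hy.elapsed t₀).config t) (hcy t)]
      exact g.variation_smul μ t (t - t₀) (c 0 t) (y t)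
    rw [e]
    have h1 := ((g.contDiff_variation μ hz hy).differentiable (by simp) t₀).hasDerivAt
    have h2 := (((hasDerivAt_id t₀).sub_const t₀).mul h1).deriv
    simp only [id_eq, sub_self, zero_mul, add_zero, one_mul] at h2
    exact h2
  have hl : SmoothFamily (n := n) fun s => (T.lowered Z).toFun t₀ (c s t₀) :=
    (T.lowered Z).smoothFamily_frozen t₀ (hc.time t₀)
  have hv : SmoothFamily (n := n) fun s => velocity (c s) t₀ :=
    (show SmoothHistories n fun s => velocity (c s) from SmoothFamily.deriv_snd hc).time t₀
  have e2 : HasDerivAt (fun s => ∫ x, (T.lowered Z).toFun t₀ (c s t₀) x ⬝ᵥ velocity (c s) t₀ x ∂μ)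
      (∫ x, (T.lowered Z).toFun t₀ (c 0 t₀) x ⬝ᵥ y t₀ x ∂μ) 0 := by
    refine ((hl.dotProduct hv).hasDerivAt_integral μ 0).congr_deriv
      (integral_congr_ae (Filter.Eventually.of_forall fun x => ?_))
    have d1 := (T.lowered Z).hasDerivAt_zero t₀ (hc.time t₀) h0 x
    have d2 := hv.hasDerivAt x 0
    have d3 : deriv (fun s => velocity (c s) t₀ x) 0 = y t₀ x := by
      refine (deriv_deriv_comm (SmoothFamily.contDiff hc x) 0 t₀).trans ?_
      simp only [hcy]
      have := (((hasDerivAt_id t₀).sub_const t₀).smul ((hy.hasDerivAt x t₀))).deriv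
      simp only [id_eq, sub_self, zero_smul, one_smul, zero_add] at this
      exact this
    refine (d1.dotProduct d2).deriv.trans ?_
    rw [d3, zero_dotProduct, zero_add]
  have hst : ∀ (κ : Measure M) [IsFiniteMeasure κ] (Q : LocalOp n m M ℝ)
      {b : ℝ → M → (Fin m → ℝ)}, SmoothFamily (n := n) b → (∀ x, deriv (fun s => b s x) 0 = 0) →
      HasDerivAt (fun s => Q.integral κ t₀ (b s)) 0 0 := fun κ _ Q b hb hb0 => by
    have h1 := (((Q.smoothFamily_frozen t₀ hb).contDiff_integral κ).differentiable
      (by simp) 0).hasDerivAt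
    have h2 := Q.deriv_integral_curve κ t₀ hb (y := 0) (contMDiff_const) hb0
    rw [Q.variation_zero] at h2
    exact h1.congr_deriv h2
  have e4 : HasDerivAt (fun s => boundaryIntegral ν V t₀ (c s t₀)) 0 0 :=
    hst (ν.restrict ((𝓡∂ n).boundary M)) V (hc.time t₀) h0
  have hZc : SmoothFamily (n := n) fun s => Z.toFun t₀ (c s t₀) :=
    Z.smoothFamily_frozen t₀ (hc.time t₀)
  have hZ0 := fun x => Z.hasDerivAt_zero t₀ (hc.time t₀) h0 x
  have hfam : SmoothFamily (n := n) fun q : ℝ × ℝ => c q.1 t₀ + q.2 • Z.toFun t₀ (c q.1 t₀) :=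
    ((hc.time t₀).comp contDiff_fst).add
      (SmoothFamily.param_smul contDiff_snd (hZc.comp contDiff_fst))
  have hF := (T.H.density.smoothFamily_frozen t₀ hfam).contDiff_integral μ
  -- The term `δ_Z H` is an `ε`-derivative along `c s t₀ + ε Z`. At fixed `ε` this curve is
  -- stationary in `s`, since `Z` is local, so the mixed derivative vanishes.
  have e3 : HasDerivAt (fun s => variation (T.H.density.integral μ t₀) (c s t₀)
      (Z.toFun t₀ (c s t₀))) 0 0 := by
    have h1 : DifferentiableAt ℝ (fun s => variation (T.H.density.integral μ t₀) (c s t₀)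
        (Z.toFun t₀ (c s t₀))) 0 := by
      have := ((SmoothFamily.deriv_at (P := ℝ) (f := fun s ε x =>
        T.H.density.toFun t₀ (c s t₀ + ε • Z.toFun t₀ (c s t₀)) x)
        (T.H.density.smoothFamily_frozen t₀ hfam) contDiff_const contDiff_id
          (s := fun _ : ℝ => 0)).contDiff_integral μ).differentiable (by simp) 0
      simpa only [T.H.density.variation_integral μ t₀ ((hc.time t₀).config _) (hZc.config _),
        id_eq] using this
    have h2 : deriv (fun s => variation (T.H.density.integral μ t₀) (c s t₀)
        (Z.toFun t₀ (c s t₀))) 0 = 0 := by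
      refine (deriv_deriv_comm hF 0 0).trans ?_
      have : ∀ ε : ℝ, deriv (fun s => T.H.density.integral μ t₀
          (c s t₀ + ε • Z.toFun t₀ (c s t₀))) 0 = 0 := fun ε =>
        (hst μ T.H.density (hfam.comp (contDiff_id.prodMk contDiff_const)) (fun x => by
          have h3 := (((hc.time t₀).hasDerivAt x 0).add ((hZ0 x).const_smul ε)).deriv
          rw [h0, smul_zero, add_zero] at h3
          exact h3)).deriv
      refine (congrArg (fun φ : ℝ → ℝ => deriv φ 0) (funext this)).trans (deriv_const _ _)
    exact h1.hasDerivAt.congr_deriv h2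
  have e5 := ((e2.add e3).add e4).deriv
  rw [add_zero, add_zero] at e5
  rw [← e1, ← e5]
  exact congrArg (fun φ : ℝ → ℝ => deriv φ 0) (funext h)

end FieldTheory

/-! ### From the balance equation to generators and back. -/

namespace FieldTheory

variable {n : ℕ} [NeZero n] {m : ℕ} {M : Type*} [TopologicalSpace M]
  [ChartedSpace (EuclideanHalfSpace n) M] [IsManifold (𝓡∂ n) ∞ M] [CompactSpace M]
  [MeasurableSpace M] [BorelSpace M]
  {μ : Measure M} [IsFiniteMeasure μ] {ι : Type*} {T : FieldTheory n m μ ι}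

/-- A local function that is the gradient of a functional for all variations preserving the
internal boundary conditions is its functional derivative at every configuration. -/
theorem isGrad_of_forall_preservesInternal [T2Space M] (hne : ∃ z : History m M, T.Admissible z)
    {g : LocalOp n m M ℝ} {Γ : LocalOp n m M (Fin m → ℝ)}
    (h : ∀ z y : History m M, T.Admissible z → T.PreservesInternal z y → ∀ t : ℝ,
      variation (g.integral μ t) (z t) (y t) = ∫ x, Γ.toFun t (z t) x ⬝ᵥ y t x ∂μ)
    (t : ℝ) (z₀ w : M → (Fin m → ℝ)) (hz₀ : SmoothConfig (n := n) z₀)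
    (hw : SmoothConfig (n := n) w) (hsupp : tsupport w ⊆ (𝓡∂ n).interior M) :
    variation (fun z => ∫ x, g.toFun t z x ∂μ) z₀ w = ∫ x, Γ.toFun t z₀ x ⬝ᵥ w x ∂μ := by
  obtain ⟨z, hz⟩ := hne
  obtain ⟨φ, hφ0, hφ1, -⟩ := exists_contMDiffMap_zero_one_nhds_of_isClosed (n := ⊤) (𝓡∂ n)
    ((𝓡∂ n).isClosed_boundary (M := M) (n := ∞) (by simp)) (isClosed_tsupport w)
    ((𝓡∂ n).disjoint_interior_boundary.symm.mono_right hsupp)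
  obtain ⟨U, hU, hbU, hU0⟩ := eventually_nhdsSet_iff_exists.1 hφ0
  obtain ⟨O, hO, hwO, hO1⟩ := eventually_nhdsSet_iff_exists.1 hφ1
  -- The correction is constant in time: `z'` agrees with `z` near the boundary at all times, hence
  -- stays admissible, and with `z₀` near the support of `w` at the chosen time `t`.
  let z' : History m M := fun s => z s + fun x => φ x • (z₀ x - z t x)
  have hd : SmoothConfig (n := n) fun x => φ x • (z₀ x - z t x) :=
    φ.contMDiff.smul (ContMDiff.sub hz₀ (hz.1.config t))
  have hz' : SmoothFamily (n := n) z' := hz.1.add hd.family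
  have hadm : T.Admissible z' := hz.congr hz' hU hbU fun s x hx => by simp [z', hU0 x hx]
  have hzO : ∀ x ∈ O, z' t x = z₀ x := fun x hx => by simp [z', hO1 x hx]
  have hw0 : ∀ x ∈ (tsupport w)ᶜ, w x = 0 := fun x hx => image_eq_zero_of_notMem_tsupport hx
  have hy : T.PreservesInternal z' fun _ => w :=
    preservesInternal_of_eqOn_zero hz' hw.family (isClosed_tsupport w).isOpen_compl
      (fun x hx hxw => (𝓡∂ n).disjoint_interior_boundary.le_bot ⟨hsupp hxw, hx⟩) fun _ => hw0
  have key := h z' (fun _ => w) hadm hy t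
  rw [g.variation_integral μ t (hz'.config t) hw] at key
  refine (g.variation_integral μ t hz₀ hw).trans (Eq.trans ?_ (key.trans ?_))
  · refine integral_congr_ae (Filter.Eventually.of_forall fun x => ?_)
    by_cases hx : x ∈ tsupport w
    · have e : ∀ ε : ℝ, g.toFun t (z₀ + ε • w) x = g.toFun t (z' t + ε • w) x := fun ε =>
        g.eq_of_eqOn t ((SmoothFamily.line hz₀ hw).config ε)
          ((SmoothFamily.line (hz'.config t) hw).config ε) hO
          (fun x hx => by simp [hzO x hx]) (hwO hx)
      simp only [e]
    · have e : ∀ b : M → (Fin m → ℝ), SmoothConfig (n := n) b → ∀ ε : ℝ,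
          g.toFun t (b + ε • w) x = g.toFun t b x := fun b hb ε =>
        g.eq_of_eqOn t ((SmoothFamily.line hb hw).config ε) hb
          (isClosed_tsupport w).isOpen_compl (fun x hx => by simp [hw0 x hx]) hx
      simp only [e _ hz₀, e _ (hz'.config t), deriv_const]
  · refine integral_congr_ae (Filter.Eventually.of_forall fun x => ?_)
    by_cases hx : x ∈ tsupport w
    · simp only [Γ.eq_of_eqOn t (hz'.config t) hz₀ hO hzO (hwO hx)]
    · simp only [hw0 x hx, dotProduct_zero]

/-- For a functional `G` without boundary terms that generates `Z`, the balance equation is the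
equation `∂_t G + {G, H}_ζ = ∮ V`. -/
theorem balance_iff_modifiedBracket {ν : Measure M}
    {Z : LocalOp n m M (Fin m → ℝ)} {V : LocalOp n m M ℝ} {G : LocalFunctional n m μ}
    (hG : T.NoBoundaryTerm G)
    (hZ : ∀ (t : ℝ) (z : M → (Fin m → ℝ)), SmoothConfig (n := n) z →
      ∀ x, Z.toFun t z x = T.σ *ᵥ G.grad.toFun t z x)
    {z : History m M} (hz : T.Admissible z) (t : ℝ) :
    T.Balance ν Z V G.density z t ↔
      deriv (fun s => G.eval s (z t)) t + LocalFunctional.modifiedBracket T.σ G T.H t (z t) =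
        boundaryIntegral ν V t (z t) := by
  have hzt := hz.1.config t
  have hX : SmoothFamily (n := n) (T.deltaH z) := T.smoothOp_deltaH.apply hz.1
  have hgrad := (G.grad.smooth_history hz.1)
  have hZ' : LocalFunctional.ham T.σ G t (z t) = Z.toFun t (z t) :=
    funext fun x => (hZ t (z t) hzt x).symm
  have hl : ∀ x, (T.lowered Z).toFun t (z t) x = G.grad.toFun t (z t) x := fun x => by
    change T.σ⁻¹ *ᵥ Z.toFun t (z t) x = _
    rw [hZ t (z t) hzt x, mulVec_mulVec, nonsing_inv_mul _ T.σ_invertible, one_mulVec]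
  have e1 := G.density.deriv_integral_history μ hz.1 t
  -- Neither variation need be free of boundary terms by itself; only the difference `ż - δ_H z`
  -- preserves the internal boundary conditions.
  have e2 : variation (G.density.integral μ t) (z t) (velocity z t) -
      variation (G.density.integral μ t) (z t) (LocalFunctional.ham T.σ T.H t (z t)) =
      (∫ x, G.grad.toFun t (z t) x ⬝ᵥ velocity z t x ∂μ) -
        ∫ x, G.grad.toFun t (z t) x ⬝ᵥ LocalFunctional.ham T.σ T.H t (z t) x ∂μ := by
    have h1 := G.density.variation_sub μ t hzt (hz.1.velocity.config t) (hX.config t)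
    have h2 := hG z _ hz hz.preservesInternal_velocity_sub t
    have h3 : ∫ x, G.grad.toFun t (z t) x ⬝ᵥ (velocity z - T.deltaH z) t x ∂μ =
        (∫ x, G.grad.toFun t (z t) x ⬝ᵥ velocity z t x ∂μ) -
        ∫ x, G.grad.toFun t (z t) x ⬝ᵥ LocalFunctional.ham T.σ T.H t (z t) x ∂μ := by
      refine Eq.trans ?_ (integral_sub (((hgrad.dotProduct hz.1.velocity).config t).integrable μ)
        (((hgrad.dotProduct hX).config t).integrable μ))
      exact integral_congr_ae (Filter.Eventually.of_forall fun x => dotProduct_sub _ _ _)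
    exact h1.symm.trans (h2.trans h3)
  have e3 : ∫ x, T.H.grad.toFun t (z t) x ⬝ᵥ Z.toFun t (z t) x ∂μ =
      -∫ x, G.grad.toFun t (z t) x ⬝ᵥ LocalFunctional.ham T.σ T.H t (z t) x ∂μ := by
    rw [← integral_neg]
    refine integral_congr_ae (Filter.Eventually.of_forall fun x => ?_)
    change T.H.grad.toFun t (z t) x ⬝ᵥ Z.toFun t (z t) x =
      -(G.grad.toFun t (z t) x ⬝ᵥ (T.σ *ᵥ T.H.grad.toFun t (z t) x))
    rw [hZ t (z t) hzt x, dotProduct_mulVec_antisymm T.σ_antisymm, dotProduct_comm]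
  -- By `e3`, `∮ Θ_H[δ_G z] = δ_Z H + {G, H}`, so the bulk bracket cancels and `{G, H}_ζ = ∮ Θ_G[δ_H
  -- z] - δ_Z H`.
  have e4 : LocalFunctional.modifiedBracket T.σ G T.H t (z t) =
      (∫ x, G.grad.toFun t (z t) x ⬝ᵥ LocalFunctional.ham T.σ T.H t (z t) x ∂μ) +
        (variation (G.density.integral μ t) (z t) (LocalFunctional.ham T.σ T.H t (z t)) -
          ∫ x, G.grad.toFun t (z t) x ⬝ᵥ LocalFunctional.ham T.σ T.H t (z t) x ∂μ) -
        (variation (T.H.density.integral μ t) (z t) (Z.toFun t (z t)) -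
          ∫ x, T.H.grad.toFun t (z t) x ⬝ᵥ Z.toFun t (z t) x ∂μ) := by
    rw [← hZ']; rfl
  have e5 : deriv (fun s => G.eval s (z t)) t =
      deriv (fun s => G.density.integral μ s (z t)) t := rfl
  unfold Balance
  rw [e5, e4, e3, e1]
  simp only [hl]
  constructor <;> intro h <;> linarith

-- Agreement on all smooth histories is required, not only on admissible ones, because the
-- commutator evaluates the transformation at `z + ε Q z`.
omit [IsManifold (𝓡∂ n) ∞ M] [CompactSpace M] [BorelSpace M] [IsFiniteMeasure μ] in
theorem BoundaryCompatible.congr {X X' : History m M → History m M}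
    (h : T.BoundaryCompatible X) (hX : ∀ z, SmoothFamily (n := n) z → X z = X' z) :
    T.BoundaryCompatible X' := by
  refine ⟨fun z hz => hX z hz.1 ▸ h.1 z hz, fun Q hQ hQ' z hz α t x hx => ?_⟩
  have hQz : SmoothFamily (n := n) (Q z) :=
    -- A zero-dimensional parameter space specialises smoothness of `Q` to a single history.
    SmoothHistories.history (P := EuclideanSpace ℝ (Fin 0)) (f := fun _ => Q z)
      (hQ 0 (fun _ => z) (SmoothHistories.const hz.1)) 0
  have e1 : vary X' (vary Q (T.chiI α)) z t x = vary X (vary Q (T.chiI α)) z t x := by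
    simp only [vary, hX z hz.1]
  have e2 : vary Q (vary X' (T.chiI α)) z t x = vary Q (vary X (T.chiI α)) z t x := by
    simp only [vary, hX _ ((SmoothHistories.line hz.1 hQz).history _)]
  rw [e1, e2]
  exact h.2 Q hQ hQ' z hz α t x hx

variable {ν : Measure M} [IsFiniteMeasure ν]

/-- An external symmetry of the action is generated by a generalized differentiable functional. -/
theorem IsExternalSymmetryWith.exists_isGenerator [T2Space M]
    (hne : ∃ z : History m M, T.Admissible z) (hreg : T.Regular)
    {Z : LocalOp n m M (Fin m → ℝ)} {V : LocalOp n m M ℝ} (h : T.IsExternalSymmetryWith ν Z V) :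
    ∃ G : LocalFunctional n m μ, T.IsGenerator ν Z V G := by
  obtain ⟨hcomp, ⟨U, hU⟩, hV⟩ := h
  have hbal : ∀ z, T.Admissible z → ∀ t,
      T.Balance ν Z V ((Z.halfPairing T.σ⁻¹).sub U) z t := fun z hz =>
    (T.forall_deriv_action_eq_iff ν Z V U hz.1).1 (hU z hz)
  have hnb : ∀ z y : History m M, T.Admissible z → T.PreservesInternal z y → ∀ t : ℝ,
      variation (((Z.halfPairing T.σ⁻¹).sub U).integral μ t) (z t) (y t) =
        ∫ x, (T.lowered Z).toFun t (z t) x ⬝ᵥ y t x ∂μ := by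
    intro z y hz hy t
    -- The elapsed time is counted from the time `t` at which the variation is to be computed.
    obtain ⟨c, hc, hc0, hcA, hcy⟩ := hreg z (elapsed t y) hz (hy.elapsed hz.1 t)
    have := variation_eq_of_balance (T := T) (ν := ν) (t₀ := t) hc hy.1.1 hcy
      fun s => hbal (c s) (hcA s) t
    rwa [hc0] at this
  let G : LocalFunctional n m μ :=
    { density := (Z.halfPairing T.σ⁻¹).sub U
      grad := T.lowered Z
      isGrad := isGrad_of_forall_preservesInternal hne hnb }
  have hZ : ∀ (t : ℝ) (z : M → (Fin m → ℝ)) (x : M),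
      T.σ *ᵥ (T.lowered Z).toFun t z x = Z.toFun t z x := fun t z x => by
    change T.σ *ᵥ (T.σ⁻¹ *ᵥ Z.toFun t z x) = _
    rw [mulVec_mulVec, mul_nonsing_inv _ T.σ_invertible, one_mulVec]
  have hGnb : T.NoBoundaryTerm G := hnb
  refine ⟨G, ⟨hGnb, hcomp.congr fun z _ => ?_⟩, fun t z _ x => (hZ t z x).symm,
    fun z hz t => ?_, hV⟩
  · funext t x
    exact (hZ t (z t) x).symm
  · exact (balance_iff_modifiedBracket hGnb (fun t z _ x => (hZ t z x).symm) hz t).1 (hbal z hz t)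

/-- A generalized differentiable functional with the evolution equation of a conserved quantity
generates an external symmetry of the action. -/
theorem IsGenerator.isExternalSymmetryWith {Z : LocalOp n m M (Fin m → ℝ)}
    {V : LocalOp n m M ℝ} {G : LocalFunctional n m μ} (h : T.IsGenerator ν Z V G) :
    T.IsExternalSymmetryWith ν Z V := by
  obtain ⟨⟨hnb, hcomp⟩, hZ, hG, hV⟩ := h
  -- This `U` is chosen so that `½ z σ Z - U` is the density of `G`.
  refine ⟨hcomp.congr fun z hz => ?_, ⟨(Z.halfPairing T.σ⁻¹).sub G.density, fun z hz => ?_⟩, hV⟩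
  · funext t x
    exact (hZ t (z t) (hz.config t) x).symm
  · refine (T.forall_deriv_action_eq_iff ν Z V _ hz.1).2 fun t => ?_
    have h1 := (balance_iff_modifiedBracket (ν := ν) hnb hZ hz t).2 (hG z hz t)
    simpa only [Balance, LocalOp.integral, LocalOp.sub, sub_sub_cancel] using h1

end FieldTheory

end ExtSym

theorem mainTheorem4 {n : ℕ} [NeZero n] {m : ℕ} {M : Type*} [TopologicalSpace M]
    [ChartedSpace (EuclideanHalfSpace n) M] [IsManifold (𝓡∂ n) ∞ M] [CompactSpace M] [T2Space M]
    [MeasurableSpace M] [BorelSpace M]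
    (μ ν : Measure M) [IsFiniteMeasure μ] [IsFiniteMeasure ν]
    (hμ : ExtSym.IsVolumeElement (n := n) μ) (hν : ExtSym.IsBoundaryVolumeElement (n := n) ν)
    {ι : Type*} (T : ExtSym.FieldTheory n m μ ι)
    (hne : ∃ z : ExtSym.History m M, T.Admissible z)
    (hreg : T.Regular)
    (hH : T.NoBoundaryTerm T.H)
    (Z : ExtSym.LocalOp n m M (Fin m → ℝ)) :
    (T.IsExternalSymmetry ν Z ↔
      ∃ (V : ExtSym.LocalOp n m M ℝ) (G : ExtSym.LocalFunctional n m μ),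
        T.IsGenerator ν Z V G) ∧
    ∀ V : ExtSym.LocalOp n m M ℝ,
      T.IsExternalSymmetryWith ν Z V ↔
        ∃ G : ExtSym.LocalFunctional n m μ, T.IsGenerator ν Z V G := by
  have key : ∀ V : ExtSym.LocalOp n m M ℝ, T.IsExternalSymmetryWith ν Z V ↔
      ∃ G : ExtSym.LocalFunctional n m μ, T.IsGenerator ν Z V G := fun V =>
    ⟨fun h => h.exists_isGenerator hne hreg, fun ⟨_, h⟩ => h.isExternalSymmetryWith⟩
  exact ⟨exists_congr key, key⟩
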